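/- **Conventions.** A pre-triangulated category satisfies Verdier's axioms except possibly the octahedron axiom; a triangulated category satisfies all of them. An exact functor commutes with the shift (up to specified coherent isomorphisms) and preserves distinguished triangles. An object $c$ of a category with small coproducts is *compact* if every morphism $c\to\coprod_{i\in I}x_i$ to a small coproduct factors through a finite sub-coproduct; the compact objects of $\mathcal S$ form the full subcategory $\mathcal S^c$. The category is *compactly generated* if it has all small coproducts and there is a set $\mathcal G$ of compact objects such that $x=0$ whenever $\operatorname{Hom}(g,x)=0$ for all $g\in\mathcal G$. For a class $\mathcal E$ of objects, $\operatorname{thick}(\mathcal E)$ is the smallest triangulated subcategory closed under direct summands and containing $\mathcal E$. Let $\mathcal S$ be a compactly generated triangulated category (locally small, "small" referring to the same universe as the Hom sets). Let $(\mathbb A,\mu,\eta)$ be an exact monad on $\mathcal S$, i.e. $\mathbb A$ is exact and $\mu,\eta$ are compatible with the shift. Assume that $\mathbb A$ is *separable*: there is a natural transformation $\sigma:\mathbb A\to\mathbb A^2$, compatible with the shift, with $\mu\circ\sigma=\mathrm{id}$ and $\mathbb A\mu\circ\sigma\mathbb A=\sigma\mu=\mu\mathbb A\circ\mathbb A\sigma$.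 Assume that $\mathbb A$ is *smashing*: it commutes with small coproducts. Let $\mathcal T=\mathbb A\text{-}\mathrm{Mod}_{\mathcal S}$ be the Eilenberg--Moore category of $\mathbb A$-modules in $\mathcal S$, with the additive structure and the shift inherited from $\mathcal S$, with the free module functor $F_{\mathbb A}:\mathcal S\to\mathcal T$ and the forgetful functor $U_{\mathbb A}:\mathcal T\to\mathcal S$. **Theorem.** 1. $\mathcal T$ has a unique pre-triangulation (class of distinguished triangles) for which $F_{\mathbb A}$ and $U_{\mathbb A}$ are exact. Moreover, let $2\le N\le\infty$ and suppose that the triangulation of $\mathcal S$ is refined to a triangulation of order $N$ for which $\mathbb A$ is exact of order $N$. Then $\mathcal T$ has a triangulation of order $N$ refining its pre-triangulation and such that $F_{\mathbb A}$ and $U_{\mathbb A}$ are exact of order $N$, and its classes of distinguished $n$-triangles, $n\le N$, are unique; if $N\ge 3$, then $\mathcal T$ satisfies the octahedron axiom, i.e. is triangulated. 2. $\mathcal T$ is compactly generated, and $\mathcal T^c=\operatorname{thick}(F_{\mathbb A}(\mathcal S^c))$. 3. If moreover $\mathbb A(\mathcal S^c)\subseteq\mathcal S^c$, then $\mathcal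 T^c=\mathbb A\text{-}\mathrm{Mod}_{\mathcal S^c}$ as full subcategories of $\mathcal T$, where the right-hand side is the category of modules over the monad induced by $\mathbb A$ on $\mathcal S^c$; and every compact object of $\mathcal T$ is a direct summand of $F_{\mathbb A}(c)$ for some $c\in\mathcal S^c$. Here an *$n$-triangle* in a category with shift $\Sigma$ is a commutative diagram $(X_{i,j})$ on the poset $\{(i,j)\in\mathbb Z^2: i\le j\le i+n+1\}$ with $X_{i,i}=0=X_{i,i+n+1}$ and with natural isomorphisms $X_{j,i+n+1}\cong\Sigma X_{i,j}$. Its *base* is $X_{0,1}\to X_{0,2}\to\dots\to X_{0,n}$ (for $n\ge1$). A *triangulation of order $N$* refining a given class of distinguished triangles consists of classes of distinguished $n$-triangles, for all finite $n\le N$, such that: they are closed under isomorphism; if $X$ is a distinguished $n$-triangle, $m\le N$, and $\varphi:\mathbb Z\to\mathbb Z$ is monotone with $\varphi(i+m+1)=\varphi(i)+n+1$, then $(X_{\varphi(i),\varphi(j)})$ is a distinguished $m$-triangle (faces, degeneracies, translations); for $n\ge 1$, every sequence of $n-1$ composable morphisms is isomorphic to the base of a distinguished $n$-triangle; every morphism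 between bases of distinguished $n$-triangles extends to a morphism of $n$-triangles; and a $2$-triangle is distinguished if and only if $X_{0,1}\to X_{0,2}\to X_{1,2}\to X_{1,3}\cong\Sigma X_{0,1}$ is a distinguished triangle. A functor commuting with the shift and preserving zero objects is *exact of order $N$* if it preserves distinguished $n$-triangles for all $n\le N$. -/

import Mathlib

open CategoryTheory CategoryTheory.Limits CategoryTheory.Pretriangulated

universe v u v' u'

namespace SepExt

/-! ### Compact objects, compact generation, thick subcategories -/

section Compact

variable {C : Type u} [Category.{v} C]

/-- An object `c` is compact if every morphism from `c` to a small coproduct `∐ i, x i` factors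
through the coproduct of a finite subfamily. Coproducts are colimit cofans. -/
def compactObjects (C : Type u) [Category.{v} C] : ObjectProperty C := fun c =>
  ∀ (I : Type v) (x : I → C) (X : Cofan x) (_ : IsColimit X) (f : c ⟶ X.pt),
    ∃ (J : Finset I) (Y : Cofan (fun j : J => x j)) (hY : IsColimit Y) (g : c ⟶ Y.pt),
      g ≫ hY.desc (Cofan.mk X.pt (fun j : J => X.inj j)) = f

/-- A category has all small coproducts and a (small) set of compact objects `g i` which
detects zero objects: `x` is zero as soon as `Hom (g i) x = 0` for all `i`. -/
def IsCompactlyGenerated (C : Type u) [Category.{v} C] [HasZeroMorphisms C] : Prop :=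
  HasCoproducts.{v} C ∧
    ∃ (ι : Type v) (g : ι → C), (∀ i, compactObjects C (g i)) ∧
      ∀ x : C, (∀ (i : ι) (f : g i ⟶ x), f = 0) → IsZero x

/-- The functor `F` commutes with small coproducts. -/
def CommutesWithCoproducts {D : Type u'} [Category.{v'} D] (F : C ⥤ D) : Prop :=
  ∀ I : Type v, Nonempty (PreservesColimitsOfShape (Discrete I) F)

/-- The smallest thick subcategory containing `P`: the intersection of all triangulated
subcategories which are closed under direct summands and contain `P`. -/
def thick [HasZeroObject C] [HasShift C ℤ] [Preadditive C]
    [∀ n : ℤ, (shiftFunctor C n).Additive] [Pretriangulated C] (P : ObjectProperty C) :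
    ObjectProperty C := fun X =>
  ∀ Q : ObjectProperty C, Q.IsTriangulated → Q.IsStableUnderRetracts → P ≤ Q → Q X

end Compact

/-! ### Separable monads -/

section Monads

variable {C : Type u} [Category.{v} C] [HasShift C ℤ]

/-- Separability of a monad (whose underlying functor commutes with the shift): the
multiplication has a section `σ : A ⟶ A²` which is `A`-linear on both sides and compatible with
the shift. -/
def IsSeparable (A : CategoryTheory.Monad C) [A.toFunctor.CommShift ℤ] : Prop :=
  ∃ σ : A.toFunctor ⟶ A.toFunctor ⋙ A.toFunctor,
    NatTrans.CommShift σ ℤ ∧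
    σ ≫ A.μ = 𝟙 A.toFunctor ∧
    (∀ X : C, σ.app (A.obj X) ≫ A.map (A.μ.app X) = A.μ.app X ≫ σ.app X) ∧
    (∀ X : C, A.map (σ.app X) ≫ A.μ.app (A.obj X) = A.μ.app X ≫ σ.app X)

end Monads

/-! ### The category of modules: shift, zero object, free and forgetful functors -/

section Modules

theorem modEqToHom_f {C : Type u} [Category.{v} C] {A : CategoryTheory.Monad C}
    {X Y : A.Algebra} (h : X = Y) :
    (eqToHom h).f = eqToHom (congrArg Monad.Algebra.A h) := by
  subst h; rfl

variable {C : Type u} [Category.{v} C] [HasShift C ℤ]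
  (A : CategoryTheory.Monad C) [A.toFunctor.CommShift ℤ]
  [NatTrans.CommShift A.η ℤ] [NatTrans.CommShift A.μ ℤ]

/-- The `n`-th shift of a module `(x, ρ)` is `x⟦n⟧` with action
`A (x⟦n⟧) ≅ (A x)⟦n⟧ ⟶ x⟦n⟧` given by `ρ⟦n⟧`. -/
noncomputable def modShiftObj (n : ℤ) (X : A.Algebra) : A.Algebra where
  A := X.A⟦n⟧
  a := (A.toFunctor.commShiftIso n).hom.app X.A ≫ X.a⟦n⟧'
  unit := by
    have h := NatTrans.shift_app_comm A.η n X.A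
    simp only [Functor.commShiftIso_id_hom_app] at h
    have h' : A.η.app (X.A⟦n⟧) ≫ (A.toFunctor.commShiftIso n).hom.app X.A =
        (A.η.app X.A)⟦n⟧' := by rw [← h]; exact Category.id_comp _
    rw [← Category.assoc, h', ← Functor.map_comp, X.unit]
    exact (shiftFunctor C n).map_id _
  assoc := by
    have h := NatTrans.shift_app_comm A.μ n X.A
    rw [Functor.commShiftIso_comp_hom_app] at h
    rw [← Category.assoc, ← h, Category.assoc, ← Functor.map_comp, X.assoc,
      Functor.map_comp, Functor.map_comp, Category.assoc, Category.assoc]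
    have h2 := A.toFunctor.commShiftIso_hom_naturality X.a n
    exact congrArg (fun t => A.map ((A.toFunctor.commShiftIso n).hom.app X.A) ≫ t) (by
      rw [← Category.assoc, ← Category.assoc]; exact congrArg (· ≫ X.a⟦n⟧') h2.symm)

/-- The shift functors on modules; on morphisms they are the shift functors of the underlying
category. -/
noncomputable def modShiftFunctor (n : ℤ) : A.Algebra ⥤ A.Algebra where
  obj X := modShiftObj A n X
  map {X Y} f :=
    { f := f.f⟦n⟧'
      h := by
        have h2 := A.toFunctor.commShiftIso_hom_naturality f.f n
        change A.map (f.f⟦n⟧') ≫ (A.toFunctor.commShiftIso n).hom.app Y.A ≫ Y.a⟦n⟧' =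
          ((A.toFunctor.commShiftIso n).hom.app X.A ≫ X.a⟦n⟧') ≫ f.f⟦n⟧'
        rw [reassoc_of% h2, Category.assoc, ← Functor.map_comp, ← Functor.map_comp, f.h] }
  map_id X := by ext; exact (shiftFunctor C n).map_id _
  map_comp f g := by ext; exact (shiftFunctor C n).map_comp _ _

/-- The shift of modules is a shift: the structure isomorphisms are those of the underlying
category. -/
noncomputable def modShiftCore : ShiftMkCore A.Algebra ℤ where
  F := modShiftFunctor A
  zero := NatIso.ofComponents
    (fun X => Monad.Algebra.isoMk ((shiftFunctorZero C ℤ).app X.A) (by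
      have h := NatTrans.naturality (shiftFunctorZero C ℤ).hom X.a
      have e : (A.toFunctor.commShiftIso (0 : ℤ)).hom.app X.A =
          A.map ((shiftFunctorZero C ℤ).hom.app X.A) ≫
            (shiftFunctorZero C ℤ).inv.app (A.obj X.A) := by
        rw [Functor.commShiftIso_zero, Functor.CommShift.isoZero_hom_app]
      change A.map ((shiftFunctorZero C ℤ).hom.app X.A) ≫ X.a =
        ((A.toFunctor.commShiftIso (0 : ℤ)).hom.app X.A ≫ X.a⟦(0 : ℤ)⟧') ≫
          (shiftFunctorZero C ℤ).hom.app X.A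
      rw [e, Category.assoc, h, Category.assoc, Iso.inv_hom_id_app_assoc]
      rfl))
    (fun f => by ext; exact (shiftFunctorZero C ℤ).hom.naturality f.f)
  add n m := NatIso.ofComponents
    (fun X => Monad.Algebra.isoMk ((shiftFunctorAdd C n m).app X.A) (by
      have h := NatTrans.naturality (shiftFunctorAdd C n m).hom X.a
      have e : (A.toFunctor.commShiftIso (n + m)).hom.app X.A =
          A.map ((shiftFunctorAdd C n m).hom.app X.A) ≫
            (A.toFunctor.commShiftIso m).hom.app (X.A⟦n⟧) ≫
              ((A.toFunctor.commShiftIso n).hom.app X.A)⟦m⟧' ≫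
                (shiftFunctorAdd C n m).inv.app (A.obj X.A) := by
        rw [Functor.commShiftIso_add, Functor.CommShift.isoAdd_hom_app]
      change A.map ((shiftFunctorAdd C n m).hom.app X.A) ≫
          ((A.toFunctor.commShiftIso m).hom.app (X.A⟦n⟧) ≫
            ((A.toFunctor.commShiftIso n).hom.app X.A ≫ X.a⟦n⟧')⟦m⟧') =
        ((A.toFunctor.commShiftIso (n + m)).hom.app X.A ≫ X.a⟦n + m⟧') ≫
          (shiftFunctorAdd C n m).hom.app X.A
      rw [e]
      simp only [Category.assoc, Functor.map_comp]
      rw [h, Iso.inv_hom_id_app_assoc]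
      rfl))
    (fun f => by ext; exact (shiftFunctorAdd C n m).hom.naturality f.f)
  assoc_hom_app a b c X := by
    ext
    refine (shiftFunctorAdd_assoc_hom_app a b c X.A).trans ?_
    rw [Monad.Algebra.comp_f, modEqToHom_f, shiftFunctorAdd']
    simp
    rfl
  zero_add_hom_app n X := by
    ext
    refine (shiftFunctorAdd_zero_add_hom_app n X.A).trans ?_
    rw [Monad.Algebra.comp_f, modEqToHom_f]
    rfl
  add_zero_hom_app n X := by
    ext
    refine (shiftFunctorAdd_add_zero_hom_app n X.A).trans ?_
    rw [Monad.Algebra.comp_f, modEqToHom_f]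
    rfl

noncomputable instance modHasShift : HasShift A.Algebra ℤ :=
  hasShiftMk A.Algebra ℤ (modShiftCore A)

/-- The forgetful functor commutes with the shift on the nose. -/
noncomputable instance forgetCommShift : A.forget.CommShift ℤ where
  commShiftIso n := NatIso.ofComponents (fun X => Iso.refl (X.A⟦n⟧)) (fun f => by
    exact (Category.comp_id _).trans (Category.id_comp _).symm)
  commShiftIso_zero := by
    ext X
    rw [Functor.CommShift.isoZero_hom_app]
    exact ((shiftFunctorZero C ℤ).hom_inv_id_app X.A).symm
  commShiftIso_add n m := by
    ext X
    rw [Functor.CommShift.isoAdd_hom_app]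
    refine ((shiftFunctorAdd C n m).hom_inv_id_app X.A).symm.trans ?_
    change _ = (shiftFunctorAdd C n m).hom.app X.A ≫ 𝟙 _ ≫ (𝟙 (X.A⟦n⟧))⟦m⟧' ≫ _
    rw [CategoryTheory.Functor.map_id, Category.id_comp]
    exact congrArg ((shiftFunctorAdd C n m).hom.app X.A ≫ ·) (Category.id_comp _).symm

/-- The free module functor commutes with the shift, through the isomorphisms
`A (x⟦n⟧) ≅ (A x)⟦n⟧`. -/
noncomputable instance freeCommShift : A.free.CommShift ℤ where
  commShiftIso n := NatIso.ofComponents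
    (fun x => Monad.Algebra.isoMk ((A.toFunctor.commShiftIso n).app x) (by
      have h := NatTrans.shift_app_comm A.μ n x
      rw [Functor.commShiftIso_comp_hom_app, Category.assoc] at h
      exact h))
    (fun f => by ext; exact (A.toFunctor.commShiftIso n).hom.naturality f)
  commShiftIso_zero := by
    ext x
    rw [Functor.CommShift.isoZero_hom_app]
    refine (congrArg (fun e => e.hom.app x) (A.toFunctor.commShiftIso_zero ℤ)).trans ?_
    rw [Functor.CommShift.isoZero_hom_app]
    rfl
  commShiftIso_add n m := by
    ext x
    rw [Functor.CommShift.isoAdd_hom_app]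
    refine (congrArg (fun e => e.hom.app x) (A.toFunctor.commShiftIso_add n m)).trans ?_
    rw [Functor.CommShift.isoAdd_hom_app]
    rfl

instance modShiftAdditive [Preadditive C] [A.toFunctor.Additive]
    [∀ n : ℤ, (shiftFunctor C n).Additive] (n : ℤ) :
    (shiftFunctor A.Algebra n).Additive where
  map_add {X Y f g} := by
    ext
    exact (shiftFunctor C n).map_add

instance freeAdditive {C : Type u} [Category.{v} C] [Preadditive C] (A : CategoryTheory.Monad C)
    [A.toFunctor.Additive] : A.free.Additive where
  map_add {X Y f g} := by
    ext
    exact A.toFunctor.map_add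

end Modules

section ZeroModule

open scoped ZeroObject

variable {C : Type u} [Category.{v} C] [Preadditive C] [HasZeroObject C]

/-- The zero object with its unique action is a zero object of the category of modules. -/
instance modHasZeroObject (A : CategoryTheory.Monad C) [A.toFunctor.Additive] :
    HasZeroObject A.Algebra where
  zero := by
    have hz : IsZero (0 : C) := isZero_zero C
    have hA : IsZero (A.obj (0 : C)) := A.toFunctor.map_isZero hz
    have hAA : IsZero (A.obj (A.obj (0 : C))) := A.toFunctor.map_isZero hA
    refine ⟨{ A := 0, a := 0, unit := hz.eq_of_src _ _, assoc := hAA.eq_of_src _ _ }, ?_⟩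
    rw [IsZero.iff_id_eq_zero]
    exact Monad.Algebra.Hom.ext (hz.eq_of_src _ _)

end ZeroModule

/-- A triangulation of the category of modules (for the shift and the additive structure inherited
from the underlying category) for which the forgetful and the free module functor are exact. -/
def IsCompatible {C : Type u} [Category.{v} C] [Preadditive C] [HasZeroObject C] [HasShift C ℤ]
    [∀ n : ℤ, (shiftFunctor C n).Additive] [Pretriangulated C]
    (A : CategoryTheory.Monad C) [A.toFunctor.CommShift ℤ] [A.toFunctor.Additive]
    [NatTrans.CommShift A.η ℤ] [NatTrans.CommShift A.μ ℤ] (P : Pretriangulated A.Algebra) :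
    Prop :=
  A.forget.IsTriangulated ∧ A.free.IsTriangulated

/-! ### Modules over the restriction of a monad to a full subcategory -/

section Restriction

variable {C : Type u} [Category.{v} C] (A : CategoryTheory.Monad C) (P : ObjectProperty C)
  (hP : ∀ x, P x → P (A.obj x))

/-- The monad induced on the full subcategory of the objects satisfying `P`, when `A`
preserves `P`. -/
@[simps!]
def restrictMonad : CategoryTheory.Monad P.FullSubcategory where
  toFunctor := P.lift (P.ι ⋙ A.toFunctor) (fun x => hP _ x.property)
  η :=
    { app := fun x => ObjectProperty.homMk (A.η.app x.obj)
      naturality := fun _ _ f => by ext; exact A.η.naturality f.hom }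
  μ :=
    { app := fun x => ObjectProperty.homMk (A.μ.app x.obj)
      naturality := fun _ _ f => by ext; exact A.μ.naturality f.hom }
  assoc x := by ext; exact A.assoc x.obj
  left_unit x := by ext; exact A.left_unit x.obj
  right_unit x := by ext; exact A.right_unit x.obj

/-- The canonical functor from the modules over the restricted monad to all modules. -/
def restrictInclusion : (restrictMonad A P hP).Algebra ⥤ A.Algebra where
  obj M :=
    { A := M.A.obj
      a := M.a.hom
      unit := congrArg (fun t : M.A ⟶ M.A => t.hom) M.unit
      assoc := congrArg InducedCategory.Hom.hom M.assoc }
  map f :=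
    { f := f.f.hom
      h := congrArg InducedCategory.Hom.hom f.h }

/-- The canonical functor is fully faithful, so that modules over the restricted monad form a
full subcategory of all modules. -/
def restrictInclusionFullyFaithful : (restrictInclusion A P hP).FullyFaithful where
  preimage g :=
    { f := ObjectProperty.homMk g.f
      h := by ext; exact g.h }

/-- The modules over the restricted monad, as a full subcategory of the category of all
modules. -/
def modulesIn : ObjectProperty A.Algebra :=
  fun X => ∃ M : (restrictMonad A P hP).Algebra, (restrictInclusion A P hP).obj M = X

end Restriction

/-! ### Higher triangles and triangulations of order `N` -/

noncomputable section Higher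

/-- The poset of pairs of integers `(i, j)` with `i ≤ j ≤ i + n + 1`. -/
abbrev TriIndex (n : ℕ) : Type := {p : ℤ × ℤ // p.1 ≤ p.2 ∧ p.2 ≤ p.1 + n + 1}

/-- The automorphism `(i, j) ↦ (j, i + n + 1)` of the index poset. -/
def TriIndex.rot (n : ℕ) : TriIndex n ⥤ TriIndex n :=
  Monotone.functor (f := fun p => ⟨(p.1.2, p.1.1 + n + 1), by have := p.2; simp; omega⟩) (by
    rintro ⟨⟨i, j⟩, h⟩ ⟨⟨i', j'⟩, h'⟩ ⟨h1, h2⟩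
    exact ⟨h2, by simpa using h1⟩)

/-- Monotone maps `φ : ℤ → ℤ` with `φ (i + (m + 1)) = φ i + (n + 1)`. They are generated by the
simplicial maps `[m] → [n]`, extended periodically, and by the translations `i ↦ i + 1`. -/
structure PeriodicMap (m n : ℕ) where
  toFun : ℤ → ℤ
  mono : Monotone toFun
  period : ∀ i, toFun (i + m + 1) = toFun i + n + 1

/-- The map of index posets `(i, j) ↦ (φ i, φ j)`. -/
def PeriodicMap.index {m n : ℕ} (φ : PeriodicMap m n) : TriIndex m ⥤ TriIndex n :=
  Monotone.functor (f := fun p => ⟨(φ.toFun p.1.1, φ.toFun p.1.2),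
      φ.mono p.2.1, (φ.mono p.2.2).trans (φ.period _).le⟩) (by
    rintro ⟨⟨i, j⟩, h⟩ ⟨⟨i', j'⟩, h'⟩ ⟨h1, h2⟩
    exact ⟨φ.mono h1, φ.mono h2⟩)

theorem PeriodicMap.index_rot {m n : ℕ} (φ : PeriodicMap m n) (p : TriIndex m) :
    φ.index.obj ((TriIndex.rot m).obj p) = (TriIndex.rot n).obj (φ.index.obj p) :=
  Subtype.ext (Prod.ext rfl (φ.period _))

variable {C : Type u} [Category.{v} C] [HasShift C ℤ]

/-- An `n`-triangle: a commutative diagram `X i j`, for `i ≤ j ≤ i + n + 1`, with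
`X i i = 0 = X i (i + n + 1)` and with natural isomorphisms `X j (i + n + 1) ≅ (X i j)⟦1⟧`.
For `n = 2` this is a sequence `x ⟶ y ⟶ z ⟶ x⟦1⟧` with vanishing composites; for `n = 3` it is
the diagram of an octahedron. -/
structure HigherTriangle (C : Type u) [Category.{v} C] [HasShift C ℤ] (n : ℕ) where
  diagram : TriIndex n ⥤ C
  isZero_left : ∀ p : TriIndex n, p.1.2 = p.1.1 → IsZero (diagram.obj p)
  isZero_right : ∀ p : TriIndex n, p.1.2 = p.1.1 + n + 1 → IsZero (diagram.obj p)
  periodicity : TriIndex.rot n ⋙ diagram ≅ diagram ⋙ shiftFunctor C (1 : ℤ)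

namespace HigherTriangle

variable {n : ℕ}

/-- A morphism of `n`-triangles is a morphism of diagrams compatible with the periodicity
isomorphisms. -/
@[ext]
structure Hom (X Y : HigherTriangle C n) where
  hom : X.diagram ⟶ Y.diagram
  comm : ∀ p : TriIndex n,
    hom.app ((TriIndex.rot n).obj p) ≫ Y.periodicity.hom.app p =
      X.periodicity.hom.app p ≫ (hom.app p)⟦(1 : ℤ)⟧'

instance : Category (HigherTriangle C n) where
  Hom := Hom
  id X := ⟨𝟙 _, fun p => by
    rw [NatTrans.id_app, NatTrans.id_app, Category.id_comp, CategoryTheory.Functor.map_id]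
    exact (Category.comp_id _).symm⟩
  comp f g := ⟨f.hom ≫ g.hom, fun p => by
    rw [NatTrans.comp_app, NatTrans.comp_app, Category.assoc, g.comm, Functor.map_comp,
      ← Category.assoc, ← Category.assoc, f.comm]⟩
  id_comp f := Hom.ext (Category.id_comp _)
  comp_id f := Hom.ext (Category.comp_id _)
  assoc f g h := Hom.ext (Category.assoc _ _ _)

/-- The `m`-triangle `(i, j) ↦ X (φ i) (φ j)`; for suitable `φ` these are the faces, the
degeneracies and the translate of `X`. -/
def pullback {m : ℕ} (X : HigherTriangle C n) (φ : PeriodicMap m n) : HigherTriangle C m where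
  diagram := φ.index ⋙ X.diagram
  isZero_left p hp := X.isZero_left _ (congrArg φ.toFun hp)
  isZero_right p hp := X.isZero_right _ ((congrArg φ.toFun hp).trans (φ.period _))
  periodicity := NatIso.ofComponents
    (fun p => X.diagram.mapIso (eqToIso (φ.index_rot p)) ≪≫ X.periodicity.app (φ.index.obj p))
    (fun {p q} f => by
      have h := X.periodicity.hom.naturality (φ.index.map f)
      simp only [Iso.trans_hom, Functor.mapIso_hom, Iso.app_hom, Functor.comp_map,
        Category.assoc] at h ⊢
      rw [← h, ← Category.assoc, ← Category.assoc, ← Functor.map_comp, ← Functor.map_comp]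
      rfl)

/-- The image of an `n`-triangle under a functor commuting with the shift and preserving zero
objects. -/
def mapFunctor {D : Type u'} [Category.{v'} D] [HasShift D ℤ] [HasZeroMorphisms C]
    [HasZeroMorphisms D] (X : HigherTriangle C n) (F : C ⥤ D) [F.CommShift ℤ]
    [F.PreservesZeroMorphisms] : HigherTriangle D n where
  diagram := X.diagram ⋙ F
  isZero_left p hp := F.map_isZero (X.isZero_left p hp)
  isZero_right p hp := F.map_isZero (X.isZero_right p hp)
  periodicity := (Functor.associator _ _ _).symm ≪≫
    Functor.isoWhiskerRight X.periodicity F ≪≫ Functor.associator _ _ _ ≪≫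
      Functor.isoWhiskerLeft X.diagram (F.commShiftIso (1 : ℤ)) ≪≫
        (Functor.associator _ _ _).symm

/-- The inclusion `k ↦ (0, k + 1)` of the base in the index poset. -/
def baseIndex (n : ℕ) : Fin (n + 1) ⥤ TriIndex (n + 1) :=
  Monotone.functor (f := fun k => ⟨(0, (k : ℤ) + 1), by have := k.2; simp; omega⟩) (by
    intro k l h
    have h' : (k : ℕ) ≤ l := h
    exact ⟨le_refl (0 : ℤ), by simpa using h'⟩)

/-- The base `X 0 1 ⟶ X 0 2 ⟶ ⋯ ⟶ X 0 (n + 1)` of an `(n + 1)`-triangle. -/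
def base (n : ℕ) : HigherTriangle C (n + 1) ⥤ ComposableArrows C n where
  obj X := baseIndex n ⋙ X.diagram
  map f := Functor.whiskerLeft (baseIndex n) f.hom

/-- The triangle `X 0 1 ⟶ X 0 2 ⟶ X 1 2 ⟶ X 1 3 ≅ (X 0 1)⟦1⟧` of a `2`-triangle. -/
def toTriangle (X : HigherTriangle C 2) : Triangle C :=
  let p₁ : TriIndex 2 := ⟨(0, 1), by norm_num⟩
  let p₂ : TriIndex 2 := ⟨(0, 2), by norm_num⟩
  let p₃ : TriIndex 2 := ⟨(1, 2), by norm_num⟩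
  Triangle.mk
    (X.diagram.map (homOfLE (show p₁ ≤ p₂ from ⟨by norm_num, by norm_num⟩)))
    (X.diagram.map (homOfLE (show p₂ ≤ p₃ from ⟨by norm_num, by norm_num⟩)))
    (X.diagram.map (homOfLE (show p₃ ≤ (TriIndex.rot 2).obj p₁ from ⟨le_refl (1 : ℤ),
      show (2 : ℤ) ≤ 0 + (2 : ℕ) + 1 by norm_num⟩)) ≫ X.periodicity.hom.app p₁)

end HigherTriangle

/-- A triangulation of order `N` (with `N = ⊤` allowed) refining a given class of distinguished
triangles: classes of distinguished `n`-triangles for `n ≤ N`, closed under isomorphisms, faces,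
degeneracies and translations, such that every sequence of `n - 1` composable morphisms is the
base of a distinguished `n`-triangle, every morphism between the bases of distinguished
`n`-triangles extends to a morphism of `n`-triangles, and the distinguished `2`-triangles are the
given distinguished triangles. -/
structure HigherTriangulation (C : Type u) [Category.{v} C] [HasZeroObject C] [HasShift C ℤ]
    [Preadditive C] [∀ n : ℤ, (shiftFunctor C n).Additive] [Pretriangulated C] (N : ℕ∞) where
  dist : ∀ n : ℕ, ObjectProperty (HigherTriangle C n)
  of_iso : ∀ n : ℕ, (n : ℕ∞) ≤ N → ∀ X Y : HigherTriangle C n, Nonempty (X ≅ Y) →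
    dist n X → dist n Y
  pullback : ∀ m n : ℕ, (m : ℕ∞) ≤ N → (n : ℕ∞) ≤ N → ∀ (φ : PeriodicMap m n)
    (X : HigherTriangle C n), dist n X → dist m (X.pullback φ)
  exists_of_base : ∀ n : ℕ, ((n + 1 : ℕ) : ℕ∞) ≤ N → ∀ B : ComposableArrows C n,
    ∃ X : HigherTriangle C (n + 1), dist (n + 1) X ∧
      Nonempty ((HigherTriangle.base n).obj X ≅ B)
  exists_hom : ∀ n : ℕ, ((n + 1 : ℕ) : ℕ∞) ≤ N → ∀ X Y : HigherTriangle C (n + 1),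
    dist (n + 1) X → dist (n + 1) Y →
      ∀ f : (HigherTriangle.base n).obj X ⟶ (HigherTriangle.base n).obj Y,
        ∃ g : X ⟶ Y, (HigherTriangle.base n).map g = f
  dist_two : (2 : ℕ∞) ≤ N → ∀ X : HigherTriangle C 2,
    dist 2 X ↔ X.toTriangle ∈ distTriang C

/-- The functor `F` maps distinguished `n`-triangles to distinguished `n`-triangles, `n ≤ N`. -/
def IsExactOfOrder {C : Type u} [Category.{v} C] [HasZeroObject C] [HasShift C ℤ]
    [Preadditive C] [∀ n : ℤ, (shiftFunctor C n).Additive] [Pretriangulated C]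
    {D : Type u'} [Category.{v'} D] [HasZeroObject D] [HasShift D ℤ]
    [Preadditive D] [∀ n : ℤ, (shiftFunctor D n).Additive] [Pretriangulated D] {N : ℕ∞}
    (F : C ⥤ D) [F.CommShift ℤ] [F.PreservesZeroMorphisms]
    (H : HigherTriangulation C N) (K : HigherTriangulation D N) : Prop :=
  ∀ n : ℕ, (n : ℕ∞) ≤ N → ∀ X : HigherTriangle C n, H.dist n X → K.dist n (X.mapFunctor F)

end Higher

end SepExt

/-! The engine is an averaging operator. Separability provides, for each module X, a section of the
action F(UX) ⟶ X that is a morphism of modules and natural in X. Following this section by F(c) and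
the action of Y turns any morphism c : UX ⟶ UY of underlying objects into a morphism of modules. The
operation respects composition with module morphisms on both sides, fixes module morphisms, and
commutes with the shift (`IsSeparable.nonempty_averaging`). Hence X is naturally a direct summand of
F(UX), and a completion problem for modules that can be solved on underlying objects can be solved
by averaging.

A triangle of modules is declared distinguished when its underlying triangle is. The delicate axiom
is the existence of a triangle over a given f : X ⟶ Y. The free triangle on Uf is distinguished and
its base has f as a retract. The corresponding idempotent of the base extends to an endomorphism e
of the triangle. Since e² - e vanishes on the base it has square zero, so 3e² - 2e³ is idempotent.
It splits because countable coproducts make the category idempotent complete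
(`isIdempotentComplete_of_hasCoproducts`). The argument needs only four properties of distinguished
triangles relative to their bases, isolated in `IsTriangleLike` and transferred to modules by
`IsTriangleLike.inverseImage`. Distinguished n-triangles have them too, the square-zero property
being inherited from their 2-triangle faces (`HigherTriangulation.sq_eq_zero`). Uniqueness follows
because objects with isomorphic bases are isomorphic (`IsTriangleLike.nonempty_iso`).

For compactness, F preserves compact objects because U commutes with coproducts, and adjunction
shows that free modules on generators generate. Conversely, for compact X the section X ⟶ F(UX)
factors through F(c) for some compact c over UX, which makes X a retract of F(c). This is
`factorsThroughCompact`: a morphism that did not factor would survive along an infinite tower of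
ghosts, whereas `exists_eq_zero_of_isGhost` shows that it dies at a finite stage. -/

namespace SepExt

/-! ### Objects controlled by their base -/

section TriangleLike

universe v₁ v₂ v₃ u₁ u₂ u₃

variable {E : Type u₁} [Category.{v₁} E] [Preadditive E]
  {M : Type u₂} [Category.{v₂} M] [Preadditive M] (B : E ⥤ M) [B.Additive]

/-- Endomorphisms of `X` which vanish on the base have square zero. -/
def SquareZeroOverBase (X : E) : Prop :=
  ∀ d : X ⟶ X, B.map d = 0 → d ≫ d = 0

variable {B}

/-- Writing f = 1 + d with d² = 0, the inverse is 1 - d = 2 - f. -/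
theorem SquareZeroOverBase.isIso_of_map_eq_id {X : E} (hX : SquareZeroOverBase B X)
    (f : X ⟶ X) (hf : B.map f = 𝟙 _) : IsIso f := by
  have h := hX (f - 𝟙 X) (by rw [B.map_sub, hf, B.map_id, sub_self])
  simp only [Preadditive.sub_comp, Preadditive.comp_sub, Category.comp_id, Category.id_comp] at h
  have h' : f ≫ f = f + f - 𝟙 X := by
    rw [← sub_eq_zero, ← h]; abel
  exact ⟨𝟙 X + 𝟙 X - f, by simp [Preadditive.comp_sub, h'], by simp [Preadditive.sub_comp, h']⟩

theorem SquareZeroOverBase.isIso {X Y : E} (hX : SquareZeroOverBase B X)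
    (hY : SquareZeroOverBase B Y) (g : X ⟶ Y) (h : Y ⟶ X)
    (hgh : B.map g ≫ B.map h = 𝟙 _) (hhg : B.map h ≫ B.map g = 𝟙 _) : IsIso g := by
  have h₁ : IsIso (g ≫ h) := hX.isIso_of_map_eq_id _ (by rw [B.map_comp, hgh])
  have h₂ : IsIso (h ≫ g) := hY.isIso_of_map_eq_id _ (by rw [B.map_comp, hhg])
  have : Mono g := mono_of_mono g h
  have : IsSplitEpi g := ⟨⟨inv (h ≫ g) ≫ h, by simp⟩⟩
  exact isIso_of_mono_of_isSplitEpi g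

omit [B.Additive] in
-- An endomorphism of the retract extends by zero to Y, and squares are computed there.
theorem SquareZeroOverBase.of_retract {X Y : E} (hY : SquareZeroOverBase B Y)
    (r : Retract X Y) : SquareZeroOverBase B X := by
  intro d hd
  have h := hY (r.r ≫ d ≫ r.i) (by simp [hd])
  calc d ≫ d = r.i ≫ ((r.r ≫ d ≫ r.i) ≫ (r.r ≫ d ≫ r.i)) ≫ r.r := by simp
    _ = 0 := by rw [h]; simp

/-- An idempotent on the base of `Y` which lifts to `Y` lifts to an idempotent of `Y`. -/
theorem SquareZeroOverBase.exists_idempotent {Y : E} (hY : SquareZeroOverBase B Y)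
    (e : Y ⟶ Y) (he : B.map e ≫ B.map e = B.map e) :
    ∃ e' : Y ⟶ Y, e' ≫ e' = e' ∧ B.map e' = B.map e := by
  have h := hY (e ≫ e - e) (by rw [B.map_sub, B.map_comp, he, sub_self])
  let a : End Y := e
  have h' : (a * a - a) * (a * a - a) = 0 := h
  have h4 : a * a * a * a = 2 • (a * a * a) - a * a := by
    rw [← sub_eq_zero, ← h']; noncomm_ring
  -- The polynomial 3x² - 2x³ lifts idempotents modulo a square-zero defect. On the base it reduces
  -- to 3e - 2e = e.
  refine ⟨(3 • (a * a) - 2 • (a * a * a) : End Y), ?_, ?_⟩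
  · change (3 • (a * a) - 2 • (a * a * a)) * (3 • (a * a) - 2 • (a * a * a)) = _
    have h5 : a * a * a * a * a = 2 • (a * a * a * a) - a * a * a := by
      rw [h4, sub_mul, smul_mul_assoc, h4]
    have h6 : a * a * a * a * a * a = 2 • (a * a * a * a * a) - a * a * a * a := by
      rw [h5, sub_mul, smul_mul_assoc, h5]
    have : (3 • (a * a) - 2 • (a * a * a)) * (3 • (a * a) - 2 • (a * a * a)) =
      9 • (a * a * a * a) - 12 • (a * a * a * a * a) + 4 • (a * a * a * a * a * a) := by
      noncomm_ring
    rw [this, h6, h5, h4]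
    noncomm_ring
  · change B.map (3 • (e ≫ e) - 2 • (e ≫ e ≫ e)) = _
    simp only [B.map_sub, B.map_nsmul, B.map_comp, he]
    abel

/-- The idempotent of the base cut out by `r` lifts to an endomorphism by fullness, is corrected to
an idempotent, and is then split. Both splittings have the same image on the base. -/
theorem SquareZeroOverBase.exists_retract [IsIdempotentComplete E] {Y : E}
    (hY : SquareZeroOverBase B Y)
    (hfull : ∀ f : B.obj Y ⟶ B.obj Y, ∃ g : Y ⟶ Y, B.map g = f) {Z : M}
    (r : Retract Z (B.obj Y)) :
    ∃ X : E, Nonempty (Retract X Y) ∧ Nonempty (B.obj X ≅ Z) := by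
  obtain ⟨e₀, he₀⟩ := hfull (r.r ≫ r.i)
  obtain ⟨e, he, he'⟩ := hY.exists_idempotent e₀ (by simp [he₀])
  obtain ⟨X, i, p, hip, hpi⟩ := IsIdempotentComplete.idempotents_split Y e he
  have h : B.map p ≫ B.map i = r.r ≫ r.i := by rw [← B.map_comp, hpi, he', he₀]
  have h' : B.map i ≫ B.map p = 𝟙 _ := by rw [← B.map_comp, hip, B.map_id]
  refine ⟨X, ⟨⟨i, p, hip⟩⟩, ⟨⟨B.map i ≫ r.r, r.i ≫ B.map p, ?_, ?_⟩⟩⟩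
  · have : B.map i ≫ r.r ≫ r.i ≫ B.map p = 𝟙 _ := by
      rw [← reassoc_of% h, h', Category.comp_id, h']
    simpa using this
  · have : r.i ≫ (B.map p ≫ B.map i) ≫ r.r = 𝟙 _ := by rw [h]; simp
    simpa using this

/-- A class of objects `P` of `E` (such as the distinguished triangles) which is related to the
base functor `B` as distinguished triangles are to their first morphisms. -/
structure IsTriangleLike (B : E ⥤ M) (P : ObjectProperty E) : Prop where
  of_iso {X Y : E} (e : X ≅ Y) : P X → P Y
  squareZero {X : E} : P X → SquareZeroOverBase B X
  exists_map_eq {X Y : E} : P X → P Y → ∀ f : B.obj X ⟶ B.obj Y, ∃ g : X ⟶ Y, B.map g = f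
  exists_obj_iso (Z : M) : ∃ X : E, P X ∧ Nonempty (B.obj X ≅ Z)

namespace IsTriangleLike

variable {P : ObjectProperty E} (hP : IsTriangleLike B P)

include hP

theorem nonempty_iso {X Y : E} (hX : P X) (hY : P Y) (e : B.obj X ≅ B.obj Y) :
    Nonempty (X ≅ Y) := by
  obtain ⟨g, hg⟩ := hP.exists_map_eq hX hY e.hom
  obtain ⟨h, hh⟩ := hP.exists_map_eq hY hX e.inv
  have := (hP.squareZero hX).isIso (hP.squareZero hY) g h (by simp [hg, hh]) (by simp [hg, hh])
  exact ⟨asIso g⟩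

/-- Compare X with a member X' of `P` over the same base. The comparison morphisms X' ⟶ Y ⟶ X and X
⟶ Y ⟶ X' are mutually inverse on bases, and X inherits the square-zero property from Y, so they are
isomorphisms. -/
theorem of_retract {X Y : E} (r : Retract X Y) (hY : P Y) : P X := by
  obtain ⟨X', hX', ⟨e⟩⟩ := hP.exists_obj_iso (B.obj X)
  obtain ⟨g, hg⟩ := hP.exists_map_eq hX' hY (e.hom ≫ B.map r.i)
  obtain ⟨h, hh⟩ := hP.exists_map_eq hY hX' (B.map r.r ≫ e.inv)
  have h₁ : B.map r.i ≫ B.map r.r = 𝟙 _ := by rw [← B.map_comp, r.retract, B.map_id]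
  have hg' : B.map (g ≫ r.r) = e.hom := by simp [hg, h₁]
  have hh' : B.map (r.i ≫ h) = e.inv := by simp [hh, reassoc_of% h₁]
  have := (hP.squareZero hX').isIso ((hP.squareZero hY).of_retract r) (g ≫ r.r) (r.i ≫ h)
    (by rw [hg', hh', e.hom_inv_id]) (by rw [hg', hh', e.inv_hom_id])
  exact hP.of_iso (asIso (g ≫ r.r)) hX'

/-- Transfer along a faithful functor `U`, when morphisms between bases lift and every base is
a retract of the base of a distinguished object. -/
theorem inverseImage {E' : Type u₃} [Category.{v₃} E'] [Preadditive E'] [IsIdempotentComplete E']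
    {M' : Type*} [Category M'] [Preadditive M'] {B' : E' ⥤ M'} [B'.Additive]
    (U : E' ⥤ E) [U.Additive] [U.Faithful]
    (hzero : ∀ {X : E'} (d : X ⟶ X), B'.map d = 0 → B.map (U.map d) = 0)
    (hfull : ∀ {X Y : E'}, P (U.obj X) → P (U.obj Y) →
      ∀ f : B'.obj X ⟶ B'.obj Y, ∃ g : X ⟶ Y, B'.map g = f)
    (hess : ∀ Z : M', ∃ Y : E', P (U.obj Y) ∧ Nonempty (Retract Z (B'.obj Y))) :
    IsTriangleLike B' (P.inverseImage U) where
  of_iso e h := hP.of_iso (U.mapIso e) h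
  squareZero h d hd := U.map_injective (by
    rw [U.map_comp, U.map_zero]
    exact hP.squareZero h _ (hzero d hd))
  exists_map_eq := hfull
  exists_obj_iso Z := by
    obtain ⟨Y, hY, ⟨r⟩⟩ := hess Z
    obtain ⟨X, ⟨r'⟩, ⟨e⟩⟩ := SquareZeroOverBase.exists_retract (B := B') (Y := Y)
      (fun d hd => U.map_injective (by
        rw [U.map_comp, U.map_zero]
        exact hP.squareZero hY _ (hzero d hd))) (hfull hY hY) r
    exact ⟨X, hP.of_retract (r'.map U) hY, ⟨e⟩⟩

end IsTriangleLike

end TriangleLike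

/-! ### Distinguished triangles over their first morphism -/

section TriangleBase

variable {C : Type u} [Category.{v} C] [HasShift C ℤ]

/-- The first morphism of a triangle, as a functor. -/
def triangleBase (C : Type u) [Category.{v} C] [HasShift C ℤ] :
    Triangle C ⥤ ComposableArrows C 1 where
  obj T := ComposableArrows.mk₁ T.mor₁
  map f := ComposableArrows.homMk₁ f.hom₁ f.hom₂ f.comm₁
  map_id _ := ComposableArrows.hom_ext₁ rfl rfl
  map_comp _ _ := ComposableArrows.hom_ext₁ rfl rfl

variable [Preadditive C] [∀ n : ℤ, (shiftFunctor C n).Additive]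

instance : (triangleBase C).Additive where
  map_add := ComposableArrows.hom_ext₁ rfl rfl

omit [∀ n : ℤ, (shiftFunctor C n).Additive] in
theorem triangleBase_map_eq_zero_iff {T T' : Triangle C} (f : T ⟶ T') :
    (triangleBase C).map f = 0 ↔ f.hom₁ = 0 ∧ f.hom₂ = 0 :=
  ⟨fun h => ⟨congr_app h 0, congr_app h 1⟩, fun h => ComposableArrows.hom_ext₁ h.1 h.2⟩

/-- For the square-zero property, an endomorphism d that vanishes on the first two vertices has a
third component which factors as `T.mor₃ ≫ k`. Then d₃ ≫ d₃ = d₃ ≫ `T.mor₃` ≫ k = `T.mor₃` ≫ d₁⟦1⟧ ≫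
k = 0. -/
theorem isTriangleLike_triangleBase [HasZeroObject C] [Pretriangulated C] :
    IsTriangleLike (triangleBase C) (fun T => T ∈ distTriang C) where
  of_iso e h := isomorphic_distinguished _ h _ e.symm
  squareZero {T} hT d hd := by
    obtain ⟨h₁, h₂⟩ := (triangleBase_map_eq_zero_iff d).1 hd
    ext
    · simp [h₁]
    · simp [h₂]
    · obtain ⟨k, hk⟩ := Triangle.yoneda_exact₃ T hT d.hom₃ (by rw [d.comm₂, h₂, zero_comp])
      change d.hom₃ ≫ d.hom₃ = 0
      nth_rw 2 [hk]
      rw [← reassoc_of% d.comm₃, h₁, Functor.map_zero, zero_comp, comp_zero]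
  exists_map_eq {T T'} hT hT' f := by
    obtain ⟨c, hc₁, hc₂⟩ := complete_distinguished_triangle_morphism T T' hT hT' (f.app 0)
      (f.app 1) (f.naturality (homOfLE (show (0 : Fin 2) ≤ 1 by simp)))
    exact ⟨⟨f.app 0, f.app 1, c, f.naturality (homOfLE (show (0 : Fin 2) ≤ 1 by simp)), hc₁, hc₂⟩,
      ComposableArrows.hom_ext₁ rfl rfl⟩
  exists_obj_iso Z := by
    obtain ⟨X, Y, f, rfl⟩ := ComposableArrows.mk₁_surjective Z
    obtain ⟨W, g, h, hT⟩ := distinguished_cocone_triangle f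
    exact ⟨_, hT, ⟨Iso.refl _⟩⟩

omit [Preadditive C] [∀ n : ℤ, (shiftFunctor C n).Additive] in
theorem isIdempotentComplete_triangle [IsIdempotentComplete C] :
    IsIdempotentComplete (Triangle C) where
  idempotents_split T e he := by
    obtain ⟨X₁, i₁, p₁, hi₁, hp₁⟩ :=
      IsIdempotentComplete.idempotents_split _ e.hom₁ (congrArg TriangleMorphism.hom₁ he)
    obtain ⟨X₂, i₂, p₂, hi₂, hp₂⟩ :=
      IsIdempotentComplete.idempotents_split _ e.hom₂ (congrArg TriangleMorphism.hom₂ he)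
    obtain ⟨X₃, i₃, p₃, hi₃, hp₃⟩ :=
      IsIdempotentComplete.idempotents_split _ e.hom₃ (congrArg TriangleMorphism.hom₃ he)
    have hi₁' : i₁ ≫ e.hom₁ = i₁ := by rw [← hp₁, reassoc_of% hi₁]
    have hi₂' : i₂ ≫ e.hom₂ = i₂ := by rw [← hp₂, reassoc_of% hi₂]
    have hi₃' : i₃ ≫ e.hom₃ = i₃ := by rw [← hp₃, reassoc_of% hi₃]
    have hp₂' : e.hom₂ ≫ p₂ = p₂ := by rw [← hp₂, Category.assoc, hi₂, Category.comp_id]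
    have hp₃' : e.hom₃ ≫ p₃ = p₃ := by rw [← hp₃, Category.assoc, hi₃, Category.comp_id]
    have hp₁' : e.hom₁ ≫ p₁ = p₁ := by rw [← hp₁, Category.assoc, hi₁, Category.comp_id]
    refine ⟨Triangle.mk (i₁ ≫ T.mor₁ ≫ p₂) (i₂ ≫ T.mor₂ ≫ p₃) (i₃ ≫ T.mor₃ ≫ p₁⟦1⟧'),
      { hom₁ := i₁, hom₂ := i₂, hom₃ := i₃, comm₁ := ?_, comm₂ := ?_, comm₃ := ?_ },
      { hom₁ := p₁, hom₂ := p₂, hom₃ := p₃, comm₁ := ?_, comm₂ := ?_, comm₃ := ?_ }, ?_, ?_⟩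
    · change (i₁ ≫ T.mor₁ ≫ p₂) ≫ i₂ = _
      rw [Category.assoc, Category.assoc, hp₂, e.comm₁, reassoc_of% hi₁']; rfl
    · change (i₂ ≫ T.mor₂ ≫ p₃) ≫ i₃ = _
      rw [Category.assoc, Category.assoc, hp₃, e.comm₂, reassoc_of% hi₂']; rfl
    · change (i₃ ≫ T.mor₃ ≫ p₁⟦1⟧') ≫ i₁⟦1⟧' = _
      rw [Category.assoc, Category.assoc, ← Functor.map_comp, hp₁, e.comm₃, reassoc_of% hi₃']; rfl
    · change _ = p₁ ≫ (i₁ ≫ T.mor₁ ≫ p₂)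
      rw [reassoc_of% hp₁, ← reassoc_of% e.comm₁, hp₂']; rfl
    · change _ = p₂ ≫ (i₂ ≫ T.mor₂ ≫ p₃)
      rw [reassoc_of% hp₂, ← reassoc_of% e.comm₂, hp₃']; rfl
    · change _ = p₃ ≫ (i₃ ≫ T.mor₃ ≫ p₁⟦1⟧')
      rw [reassoc_of% hp₃, ← reassoc_of% e.comm₃, ← Functor.map_comp, hp₁']; rfl
    · ext
      exacts [hi₁, hi₂, hi₃]
    · ext
      exacts [hp₁, hp₂, hp₃]

end TriangleBase

/-! ### Splitting idempotents with countable coproducts -/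

section IdempotentComplete

variable {C : Type u} [Category.{v} C] [HasShift C ℤ] [Preadditive C] [HasZeroObject C]
  [∀ n : ℤ, (shiftFunctor C n).Additive] [Pretriangulated C]

/-- If `1 - r s` is split as `p ≫ i` then so is `s r`. -/
theorem exists_splitting_of_complement {Z X : C} {i : Z ⟶ Z} {p : Z ⟶ Z} (hip : i ≫ p = 𝟙 Z)
    {s : X ⟶ Z} {r : Z ⟶ X} (hrs : r ≫ s + p ≫ i = 𝟙 Z) (e : X ⟶ X) (hsr : s ≫ r = e)
    (he : e ≫ e = e) : ∃ (Y : C) (j : Y ⟶ X) (q : X ⟶ Y), j ≫ q = 𝟙 Y ∧ q ≫ j = e := by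
  -- The cone of the split monomorphism i is its cokernel. As `r ≫ s` kills i it factors through g,
  -- which yields a section t of g. Thus Y is the image of `r ≫ s`, and r and s carry the splitting
  -- over to X.
  obtain ⟨Y, g, h, hT⟩ := distinguished_cocone_triangle i
  have : Mono i := mono_of_mono_fac hip
  have hig : i ≫ g = 0 := comp_distTriang_mor_zero₁₂ _ hT
  have hg : Epi g := Triangle.epi₂ _ hT (Triangle.mor₃_eq_zero_of_mono₁ _ hT this)
  have hrsg : r ≫ s ≫ g = g := by
    have := congrArg (· ≫ g) hrs
    simpa [hig] using this
  have hirs : i ≫ r ≫ s = 0 := by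
    have := congrArg (i ≫ ·) hrs
    simpa [reassoc_of% hip] using this
  obtain ⟨t, ht⟩ : ∃ t : Y ⟶ Z, r ≫ s = g ≫ t := Triangle.yoneda_exact₂ _ hT _ hirs
  have htg : t ≫ g = 𝟙 Y := by
    rw [← cancel_epi g, ← reassoc_of% ht, hrsg, Category.comp_id]
  refine ⟨Y, t ≫ r, s ≫ g, ?_, ?_⟩
  · rw [Category.assoc, hrsg, htg]
  · rw [Category.assoc, ← reassoc_of% ht, reassoc_of% hsr, hsr, he]

/-- A pretriangulated category with countable coproducts is idempotent complete. -/
theorem isIdempotentComplete_of_hasCoproducts (hC : HasCoproducts.{v} C) :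
    IsIdempotentComplete C where
  idempotents_split X e he := by
    obtain ⟨Z, ι, ext, hd⟩ : ∃ (Z : C) (ι : ℕ → (X ⟶ Z)),
        (∀ {Y : C} (f g : Z ⟶ Y), (∀ n, ι n ≫ f = ι n ≫ g) → f = g) ∧
        (∀ {Y : C} (f : ℕ → (X ⟶ Y)), ∃ g : Z ⟶ Y, ∀ n, ι n ≫ g = f n) := by
      have := hC (ULift.{v} ℕ)
      exact ⟨∐ (fun _ : ULift.{v} ℕ => X), fun n => Sigma.ι (fun _ : ULift.{v} ℕ => X) ⟨n⟩,
        fun f g h => Sigma.hom_ext _ _ (fun n => h n.down),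
        fun f => ⟨Sigma.desc (fun n => f n.down), fun n => by simp⟩⟩
    choose d hd using @hd
    have hdr {Y : C} (f : ℕ → (X ⟶ Y)) (n : ℕ) {W : C} (g : Y ⟶ W) :
        ι n ≫ d f ≫ g = f n ≫ g := by
      rw [← Category.assoc, hd]
    have key (n : ℕ) : e ≫ ∑ k ∈ Finset.range n, e ≫ ι k = ∑ k ∈ Finset.range n, e ≫ ι k := by
      simp [Preadditive.comp_sum, reassoc_of% he]
    -- Here i is 1 minus the map sending the n-th copy of X to the next one by e; its cone is the
    -- homotopy colimit of X ⟶ X ⟶ ⋯ along e. The map p, which subtracts e ≫ ι k for all k ≤ n, is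
    -- an explicit retraction of i. The complementary idempotent `r ≫ s` factors through X, where it
    -- becomes e.
    refine exists_splitting_of_complement
      (i := d (fun n => ι n - e ≫ ι (n + 1)))
      (p := d (fun n => ι n - e ≫ ι n - ∑ k ∈ Finset.range n, e ≫ ι k))
      ?_ (s := e ≫ ι 0) (r := d (fun _ => e)) ?_ e ?_ he
    · apply ext
      intro n
      rw [hdr, Category.comp_id, Preadditive.sub_comp, Category.assoc, hd, hd,
        Preadditive.comp_sub, Preadditive.comp_sub, reassoc_of% he, key, Finset.sum_range_succ]
      abel
    · apply ext
      intro n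
      have tel : (∑ k ∈ Finset.range n, e ≫ ι k) ≫ d (fun n => ι n - e ≫ ι (n + 1)) =
          e ≫ ι 0 - e ≫ ι n := by
        rw [Preadditive.sum_comp]
        simp only [Category.assoc, hd, Preadditive.comp_sub, reassoc_of% he]
        exact Finset.sum_range_sub' (fun k => e ≫ ι k) n
      rw [Preadditive.comp_add, hdr, hdr, Preadditive.sub_comp, Preadditive.sub_comp, tel,
        Category.assoc, hd, Preadditive.comp_sub, reassoc_of% he, reassoc_of% he, Category.comp_id]
      abel
    · rw [Category.assoc, hd, he]

end IdempotentComplete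

/-! ### The averaging operator of a separable monad -/

section Averaging

variable {C : Type u} [Category.{v} C] [HasShift C ℤ]
  (A : CategoryTheory.Monad C) [A.toFunctor.CommShift ℤ]
  [NatTrans.CommShift A.η ℤ] [NatTrans.CommShift A.μ ℤ]

/-- A projection, natural in both variables and compatible with the shift, of the morphisms
between the underlying objects of two modules onto the morphisms of modules. -/
structure Averaging where
  avg {X Y : A.Algebra} (c : X.A ⟶ Y.A) : X ⟶ Y
  avg_precomp {X' X Y : A.Algebra} (f : X' ⟶ X) (c : X.A ⟶ Y.A) : avg (f.f ≫ c) = f ≫ avg c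
  avg_postcomp {X Y Y' : A.Algebra} (c : X.A ⟶ Y.A) (g : Y ⟶ Y') : avg (c ≫ g.f) = avg c ≫ g
  avg_f {X Y : A.Algebra} (f : X ⟶ Y) : avg f.f = f
  avg_shift {X Y : A.Algebra} (c : X.A ⟶ Y.A) :
    avg (X := X⟦(1 : ℤ)⟧) (Y := Y⟦(1 : ℤ)⟧) (c⟦(1 : ℤ)⟧') = (avg c)⟦(1 : ℤ)⟧'

variable {A}

/-- The averaging operator of a separable monad sends `c` to
`η ≫ σ ≫ A a ≫ A c ≫ a`. -/
theorem IsSeparable.nonempty_averaging (h : IsSeparable A) : Nonempty (Averaging A) := by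
  obtain ⟨σ, hσ, h₁, h₂, h₃⟩ := h
  have h₁' (X : C) : σ.app X ≫ A.μ.app X = 𝟙 _ := congr_app h₁ X
  have nat {X Y : C} (f : X ⟶ Y) : A.map f ≫ σ.app Y = σ.app X ≫ A.map (A.map f) :=
    σ.naturality f
  have natη {X Y : C} (f : X ⟶ Y) : f ≫ A.η.app Y = A.η.app X ≫ A.map f := A.η.naturality f
  have natμ {X Y : C} (f : X ⟶ Y) : A.map (A.map f) ≫ A.μ.app Y = A.μ.app X ≫ A.map f :=
    A.μ.naturality f
  -- This is the natural section of the action. `s_lin` shows that it is a morphism from X to the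
  -- free module; it uses both linearity identities of σ, each side reducing to σ followed by the
  -- action.
  let s (X : A.Algebra) : X.A ⟶ A.obj X.A := A.η.app X.A ≫ σ.app X.A ≫ A.map X.a
  have s_nat {X Y : A.Algebra} (f : X ⟶ Y) : f.f ≫ s Y = s X ≫ A.map f.f := by
    simp only [s, Category.assoc]
    rw [reassoc_of% natη f.f, reassoc_of% nat f.f, ← A.map_comp, f.h, A.map_comp]
  have s_a (X : A.Algebra) : s X ≫ X.a = 𝟙 _ := by
    simp only [s, Category.assoc, ← X.assoc, reassoc_of% h₁', X.unit]
  have hA (X : A.Algebra) : A.η.app (A.obj X.A) ≫ A.map X.a = X.a ≫ A.η.app X.A :=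
    (natη X.a).symm
  have s_lin (X : A.Algebra) : A.map (s X) ≫ A.μ.app X.A = X.a ≫ s X := by
    have e1 : A.map (s X) ≫ A.μ.app X.A = σ.app X.A ≫ A.map X.a := by
      simp only [s, A.map_comp, Category.assoc, natμ]
      rw [reassoc_of% h₃ X.A, A.right_unit_assoc]
    have e2 : X.a ≫ s X = σ.app X.A ≫ A.map X.a := by
      rw [← reassoc_of% hA X, reassoc_of% nat X.a, ← A.map_comp, ← X.assoc, A.map_comp,
        reassoc_of% h₂ X.A, A.left_unit_assoc]
    rw [e1, e2]
  refine ⟨{ avg := fun {X Y} c => { f := s X ≫ A.map c ≫ Y.a, h := ?_ }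
            avg_precomp := ?_, avg_postcomp := ?_, avg_f := ?_, avg_shift := ?_ }⟩
  · simp only [A.map_comp, Category.assoc]
    rw [← Y.assoc, reassoc_of% natμ, reassoc_of% s_lin]
  · intro X' X Y f c
    ext
    simp [reassoc_of% s_nat]
  · intro X Y Y' c g
    ext
    simp
  · intro X Y f
    ext
    change s X ≫ A.map f.f ≫ Y.a = f.f
    rw [f.h, reassoc_of% s_a]
  · intro X Y c
    ext
    have hη := NatTrans.shift_app_comm A.η (1 : ℤ) X.A
    simp only [Functor.commShiftIso_id_hom_app] at hη
    have hη' : A.η.app (X.A⟦(1 : ℤ)⟧) ≫ (A.toFunctor.commShiftIso (1 : ℤ)).hom.app X.A =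
        (A.η.app X.A)⟦(1 : ℤ)⟧' := by rw [← hη]; exact Category.id_comp _
    have hσ' := NatTrans.shift_app_comm σ (1 : ℤ) X.A
    rw [Functor.commShiftIso_comp_hom_app] at hσ'
    have hX : A.map ((X.a)⟦(1 : ℤ)⟧') ≫ (A.toFunctor.commShiftIso (1 : ℤ)).hom.app X.A =
      (A.toFunctor.commShiftIso (1 : ℤ)).hom.app (A.obj X.A) ≫ (A.map X.a)⟦(1 : ℤ)⟧' :=
      A.toFunctor.commShiftIso_hom_naturality X.a 1
    have hc : A.map (c⟦(1 : ℤ)⟧') ≫ (A.toFunctor.commShiftIso (1 : ℤ)).hom.app Y.A =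
      (A.toFunctor.commShiftIso (1 : ℤ)).hom.app X.A ≫ (A.map c)⟦(1 : ℤ)⟧' :=
      A.toFunctor.commShiftIso_hom_naturality c 1
    have e : s (X⟦(1 : ℤ)⟧) ≫ (A.toFunctor.commShiftIso (1 : ℤ)).hom.app X.A = (s X)⟦(1 : ℤ)⟧' := by
      change (A.η.app (X.A⟦(1 : ℤ)⟧) ≫ σ.app (X.A⟦(1 : ℤ)⟧) ≫
        A.map ((A.toFunctor.commShiftIso (1 : ℤ)).hom.app X.A ≫ X.a⟦(1 : ℤ)⟧')) ≫ _ = _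
      simp only [s, Functor.map_comp, Category.assoc]
      rw [hX, ← reassoc_of% hσ', reassoc_of% hη']
    have key (t : X.A⟦(1 : ℤ)⟧ ⟶ A.obj (X.A⟦(1 : ℤ)⟧))
        (ht : t ≫ (A.toFunctor.commShiftIso (1 : ℤ)).hom.app X.A = (s X)⟦(1 : ℤ)⟧') :
        t ≫ A.map (c⟦(1 : ℤ)⟧') ≫
          (A.toFunctor.commShiftIso (1 : ℤ)).hom.app Y.A ≫ Y.a⟦(1 : ℤ)⟧' =
            (s X ≫ A.map c ≫ Y.a)⟦(1 : ℤ)⟧' := by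
      rw [reassoc_of% hc, reassoc_of% ht, ← Functor.map_comp, ← Functor.map_comp]
    exact key _ e

/-- Every module is a retract of the free module on its underlying object. -/
def Averaging.retract (α : Averaging A) (X : A.Algebra) : Retract X (A.free.obj X.A) where
  i := α.avg (A.η.app X.A)
  r := { f := X.a, h := X.assoc.symm }
  retract := (α.avg_postcomp (Y := A.free.obj X.A) (A.η.app X.A) _).symm.trans
    ((congrArg α.avg X.unit).trans (α.avg_f (𝟙 X)))

theorem Averaging.retract_i_naturality (α : Averaging A) {X Y : A.Algebra} (f : X ⟶ Y) :
    f ≫ (α.retract Y).i = (α.retract X).i ≫ A.free.map f.f :=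
  (α.avg_precomp (Y := A.free.obj Y.A) f (A.η.app Y.A)).symm.trans
    ((congrArg α.avg (A.η.naturality f.f)).trans
      (α.avg_postcomp (Y := A.free.obj X.A) (A.η.app X.A) (A.free.map f.f)))

theorem Averaging.retract_r_naturality (α : Averaging A) {X Y : A.Algebra} (f : X ⟶ Y) :
    (α.retract X).r ≫ f = A.free.map f.f ≫ (α.retract Y).r :=
  Monad.Algebra.Hom.ext f.h.symm

end Averaging

theorem isIdempotentComplete_algebra {C : Type u} [Category.{v} C] [IsIdempotentComplete C]
    (A : CategoryTheory.Monad C) :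
    IsIdempotentComplete A.Algebra where
  idempotents_split X e he := by
    obtain ⟨Y, i, p, hip, hpi⟩ :=
      IsIdempotentComplete.idempotents_split X.A e.f (congrArg Monad.Algebra.Hom.f he)
    have hi : i ≫ e.f = i := by rw [← hpi, reassoc_of% hip]
    have hp : e.f ≫ p = p := by rw [← hpi, Category.assoc, hip, Category.comp_id]
    let Z : A.Algebra :=
      { A := Y
        a := A.map i ≫ X.a ≫ p
        unit := by
          have := A.η.naturality i
          dsimp at this
          rw [← reassoc_of% this, X.unit_assoc, hip]
        assoc := by
          have := A.μ.naturality i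
          dsimp at this
          simp only [A.map_comp, Category.assoc]
          rw [← reassoc_of% this, X.assoc_assoc, ← A.map_comp_assoc p i, hpi, e.h_assoc, hp] }
    refine ⟨Z, ⟨i, ?_⟩, ⟨p, ?_⟩, Monad.Algebra.Hom.ext hip, Monad.Algebra.Hom.ext hpi⟩
    · change _ = (A.map i ≫ X.a ≫ p) ≫ i
      rw [Category.assoc, Category.assoc, hpi, ← e.h, ← A.map_comp_assoc, hi]
    · change A.map p ≫ (A.map i ≫ X.a ≫ p) = _
      rw [← A.map_comp_assoc, hpi, e.h_assoc, hp]

/-! ### The pretriangulation of the category of modules -/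

section Pretriangulation

variable {C : Type u} [Category.{v} C] [HasZeroObject C] [HasShift C ℤ] [Preadditive C]
  [∀ n : ℤ, (shiftFunctor C n).Additive] [Pretriangulated C]
  {A : CategoryTheory.Monad C} [A.toFunctor.CommShift ℤ] [A.toFunctor.IsTriangulated]
  [NatTrans.CommShift A.η ℤ] [NatTrans.CommShift A.μ ℤ]

theorem contractible_mem_mod (X : A.Algebra) :
    A.forget.mapTriangle.obj (contractibleTriangle X) ∈ distTriang C :=
  isomorphic_distinguished _ (contractible_distinguished X.A) _
    (Triangle.isoMk _ _ (Iso.refl _) (Iso.refl _) (A.forget.mapZeroObject) rfl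
      ((isZero_zero C).eq_of_tgt _ _) ((A.forget.map_isZero (isZero_zero _)).eq_of_src _ _))

omit [A.toFunctor.IsTriangulated] in
-- Average a filler found on underlying objects. Both squares survive because the other morphisms in
-- them are already morphisms of modules.
theorem exists_mod_hom_of_distinguished (α : Averaging A) (T₁ T₂ : Triangle A.Algebra)
    (h₁ : A.forget.mapTriangle.obj T₁ ∈ distTriang C)
    (h₂ : A.forget.mapTriangle.obj T₂ ∈ distTriang C)
    (a : T₁.obj₁ ⟶ T₂.obj₁) (b : T₁.obj₂ ⟶ T₂.obj₂) (comm : T₁.mor₁ ≫ b = a ≫ T₂.mor₁) :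
    ∃ c : T₁.obj₃ ⟶ T₂.obj₃, T₁.mor₂ ≫ c = b ≫ T₂.mor₂ ∧ T₁.mor₃ ≫ a⟦1⟧' = c ≫ T₂.mor₃ := by
  obtain ⟨c, hc₁, hc₂⟩ : ∃ c : T₁.obj₃.A ⟶ T₂.obj₃.A, T₁.mor₂.f ≫ c = (b ≫ T₂.mor₂).f ∧
      (T₁.mor₃ ≫ a⟦(1 : ℤ)⟧').f = c ≫ T₂.mor₃.f := by
    obtain ⟨c, hc₁, hc₂⟩ := complete_distinguished_triangle_morphism _ _ h₁ h₂ a.f b.f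
      (congrArg Monad.Algebra.Hom.f comm)
    exact ⟨c, hc₁, (congrArg (· ≫ a.f⟦(1 : ℤ)⟧') (Category.comp_id T₁.mor₃.f).symm).trans
      (hc₂.trans (congrArg (c ≫ ·) (Category.comp_id T₂.mor₃.f)))⟩
  refine ⟨α.avg c, ?_, ?_⟩
  · rw [← α.avg_precomp, hc₁, α.avg_f]
  · rw [← α.avg_postcomp, ← hc₂, α.avg_f]

theorem forget_map_free_map_triangle_mem {T : Triangle C} (hT : T ∈ distTriang C) :
    A.forget.mapTriangle.obj (A.free.mapTriangle.obj T) ∈ distTriang C :=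
  isomorphic_distinguished _ (A.toFunctor.map_distinguished T hT) _
    (Triangle.isoMk _ _ (Iso.refl _) (Iso.refl _) (Iso.refl _) (by
      change A.map T.mor₁ ≫ 𝟙 _ = 𝟙 _ ≫ A.map T.mor₁
      simp) (by
      change A.map T.mor₂ ≫ 𝟙 _ = 𝟙 _ ≫ A.map T.mor₂
      simp) (by
      change ((A.map T.mor₃ ≫ (A.toFunctor.commShiftIso (1 : ℤ)).hom.app T.obj₁) ≫ 𝟙 _) ≫
        (𝟙 (A.obj T.obj₁))⟦(1 : ℤ)⟧' =
          𝟙 _ ≫ (A.map T.mor₃ ≫ (A.toFunctor.commShiftIso (1 : ℤ)).hom.app T.obj₁)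
      simp))

/-- Triangles of modules whose underlying triangle is distinguished. -/
theorem isTriangleLike_mod [IsIdempotentComplete C] (α : Averaging A) :
    IsTriangleLike (triangleBase A.Algebra)
      (fun T => A.forget.mapTriangle.obj T ∈ distTriang C) := by
  have := isIdempotentComplete_algebra A
  have := isIdempotentComplete_triangle (C := A.Algebra)
  have : A.forget.mapTriangle.Additive :=
    ⟨fun {T T' f g} => by ext <;> rfl⟩
  refine isTriangleLike_triangleBase.inverseImage A.forget.mapTriangle ?_ ?_ ?_
  · intro T d hd
    rw [triangleBase_map_eq_zero_iff] at hd ⊢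
    exact ⟨congrArg Monad.Algebra.Hom.f hd.1, congrArg Monad.Algebra.Hom.f hd.2⟩
  · intro T T' hT hT' f
    have comm := f.naturality (homOfLE (show (0 : Fin 2) ≤ 1 by simp))
    obtain ⟨c, hc₁, hc₂⟩ := exists_mod_hom_of_distinguished α T T' hT hT' (f.app 0)
      (f.app 1) comm
    exact ⟨⟨f.app 0, f.app 1, c, comm, hc₁, hc₂⟩, ComposableArrows.hom_ext₁ rfl rfl⟩
  · intro Z
    obtain ⟨X, Y, f, rfl⟩ := ComposableArrows.mk₁_surjective Z
    obtain ⟨W, g, h, hT⟩ := distinguished_cocone_triangle f.f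
    -- The base of this free triangle is the free morphism on the underlying morphism of f, and f is
    -- a retract of it by naturality of `α.retract`.
    refine ⟨A.free.mapTriangle.obj (Triangle.mk f.f g h), forget_map_free_map_triangle_mem hT,
      ⟨{ i := ComposableArrows.homMk₁ (α.retract X).i (α.retract Y).i
          (α.retract_i_naturality f)
         r := ComposableArrows.homMk₁ (α.retract X).r (α.retract Y).r
          (α.retract_r_naturality f).symm
         retract := ComposableArrows.hom_ext₁ (α.retract X).retract (α.retract Y).retract }⟩⟩

/-- The pretriangulation of the category of modules over a separable monad: a triangle of modules
is distinguished when its underlying triangle is. -/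
@[reducible]
def modPretriangulated [IsIdempotentComplete C] (α : Averaging A) : Pretriangulated A.Algebra where
  distinguishedTriangles := {T | A.forget.mapTriangle.obj T ∈ distTriang C}
  isomorphic_distinguished T hT T' e :=
    isomorphic_distinguished _ hT _ (A.forget.mapTriangle.mapIso e)
  contractible_distinguished X := contractible_mem_mod X
  distinguished_cocone_triangle {X Y} f := by
    obtain ⟨T, hT, ⟨e⟩⟩ := (isTriangleLike_mod α).exists_obj_iso (ComposableArrows.mk₁ f)
    let e₁ : T.obj₁ ≅ X := e.app 0
    let e₂ : T.obj₂ ≅ Y := e.app 1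
    have comm : T.mor₁ ≫ e₂.hom = e₁.hom ≫ f :=
      e.hom.naturality (homOfLE (show (0 : Fin 2) ≤ 1 by simp))
    refine ⟨T.obj₃, e₂.inv ≫ T.mor₂, T.mor₃ ≫ e₁.hom⟦(1 : ℤ)⟧',
      isomorphic_distinguished _ hT _ (A.forget.mapTriangle.mapIso
        (Triangle.isoMk _ _ e₁.symm e₂.symm (Iso.refl _) ?_ ?_ ?_))⟩
    · change f ≫ e₂.inv = e₁.inv ≫ T.mor₁
      rw [Iso.comp_inv_eq, Category.assoc, comm, Iso.inv_hom_id_assoc]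
    · change (e₂.inv ≫ T.mor₂) ≫ 𝟙 _ = e₂.inv ≫ T.mor₂
      rw [Category.comp_id]
    · change (T.mor₃ ≫ e₁.hom⟦(1 : ℤ)⟧') ≫ e₁.inv⟦(1 : ℤ)⟧' = 𝟙 _ ≫ T.mor₃
      rw [Category.assoc, ← Functor.map_comp, e₁.hom_inv_id, CategoryTheory.Functor.map_id,
        Category.comp_id, Category.id_comp]
  rotate_distinguished_triangle T :=
    (rotate_distinguished_triangle _).trans
      (distinguished_iff_of_iso (A.forget.mapTriangleRotateIso.app T))
  complete_distinguished_triangle_morphism T₁ T₂ h₁ h₂ a b comm :=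
    exists_mod_hom_of_distinguished α T₁ T₂ h₁ h₂ a b comm

theorem modPretriangulated_isCompatible [IsIdempotentComplete C] (α : Averaging A) :
    IsCompatible A (modPretriangulated α) :=
  letI := modPretriangulated α
  ⟨⟨fun _ hT => hT⟩, ⟨fun _ hT => forget_map_free_map_triangle_mem hT⟩⟩

/-- Exactness of the forgetful functor gives one inclusion. For the other, `P` has a distinguished
triangle over the same base; it lies in the larger class, where the base determines the triangle up
to isomorphism. -/
theorem eq_modPretriangulated [IsIdempotentComplete C] (α : Averaging A)
    (P : Pretriangulated A.Algebra) (hP : IsCompatible A P) : P = modPretriangulated α := by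
  have h₁ : P.distinguishedTriangles ⊆ (modPretriangulated α).distinguishedTriangles :=
    fun T hT => hP.1.map_distinguished T hT
  have h₂ : (modPretriangulated α).distinguishedTriangles ⊆ P.distinguishedTriangles := by
    intro T hT
    obtain ⟨T', hT', ⟨e⟩⟩ := (isTriangleLike_triangleBase (C := A.Algebra)).exists_obj_iso
      ((triangleBase A.Algebra).obj T)
    obtain ⟨e'⟩ := (isTriangleLike_mod α).nonempty_iso (h₁ hT') hT e
    exact P.isomorphic_distinguished _ hT' _ e'.symm
  have ext : ∀ P Q : Pretriangulated A.Algebra,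
      P.distinguishedTriangles = Q.distinguishedTriangles → P = Q := by
    rintro ⟨⟩ ⟨⟩ rfl
    rfl
  exact ext _ _ (h₁.antisymm h₂)

end Pretriangulation

theorem comp_shift_map_id {C : Type u} [Category.{v} C] [HasShift C ℤ] {X Y : C} {n : ℤ}
    (f : X ⟶ Y⟦n⟧) : f ≫ (𝟙 Y)⟦n⟧' = f := by
  rw [CategoryTheory.Functor.map_id, Category.comp_id]

noncomputable section

/-! ### The additive category of n-triangles and its functoriality -/

namespace HigherTriangle

section Basic

variable {C : Type u} [Category.{v} C] [HasShift C ℤ] {n : ℕ}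

@[ext]
theorem hom_ext {X Y : HigherTriangle C n} {f g : X ⟶ Y} (h : f.hom = g.hom) : f = g :=
  Hom.ext h

/-- Isomorphisms of `n`-triangles from isomorphisms of diagrams. -/
def isoMk {X Y : HigherTriangle C n} (e : X.diagram ≅ Y.diagram)
    (h : ∀ p : TriIndex n, e.hom.app ((TriIndex.rot n).obj p) ≫ Y.periodicity.hom.app p =
      X.periodicity.hom.app p ≫ (e.hom.app p)⟦(1 : ℤ)⟧') : X ≅ Y where
  hom := ⟨e.hom, h⟩
  inv := ⟨e.inv, fun p => by
    have h₁ : (e.hom.app p)⟦(1 : ℤ)⟧' ≫ (e.inv.app p)⟦(1 : ℤ)⟧' = 𝟙 _ := by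
      rw [← Functor.map_comp, e.hom_inv_id_app, CategoryTheory.Functor.map_id]
    rw [← cancel_epi (e.hom.app ((TriIndex.rot n).obj p)), e.hom_inv_id_app_assoc,
      reassoc_of% h p, h₁]
    exact (Category.comp_id _).symm⟩
  hom_inv_id := hom_ext e.hom_inv_id
  inv_hom_id := hom_ext e.inv_hom_id

/-- Functoriality of faces, degeneracies and translations. -/
def pullbackMap {m : ℕ} (φ : PeriodicMap m n) {X Y : HigherTriangle C n} (f : X ⟶ Y) :
    X.pullback φ ⟶ Y.pullback φ where
  hom := Functor.whiskerLeft φ.index f.hom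
  comm p := by
    have h := f.hom.naturality (eqToHom (φ.index_rot p))
    change f.hom.app (φ.index.obj ((TriIndex.rot m).obj p)) ≫
        Y.diagram.map (eqToHom (φ.index_rot p)) ≫ Y.periodicity.hom.app (φ.index.obj p) =
      (X.diagram.map (eqToHom (φ.index_rot p)) ≫ X.periodicity.hom.app (φ.index.obj p)) ≫
        (f.hom.app (φ.index.obj p))⟦(1 : ℤ)⟧'
    rw [← reassoc_of% h, f.comm, Category.assoc]

theorem periodicity_naturality {X Y : HigherTriangle C n} (f : X ⟶ Y) {p q : TriIndex n}
    (u : q ⟶ (TriIndex.rot n).obj p) :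
    (X.diagram.map u ≫ X.periodicity.hom.app p) ≫ (f.hom.app p)⟦(1 : ℤ)⟧' =
      f.hom.app q ≫ Y.diagram.map u ≫ Y.periodicity.hom.app p := by
  rw [Category.assoc]
  refine (congrArg (X.diagram.map u ≫ ·) (f.comm p)).symm.trans ?_
  rw [← Category.assoc, f.hom.naturality, Category.assoc]

/-- Functoriality of the triangle of a `2`-triangle. -/
def toTriangleMap {X Y : HigherTriangle C 2} (f : X ⟶ Y) : X.toTriangle ⟶ Y.toTriangle where
  hom₁ := f.hom.app ⟨(0, 1), by norm_num⟩
  hom₂ := f.hom.app ⟨(0, 2), by norm_num⟩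
  hom₃ := f.hom.app ⟨(1, 2), by norm_num⟩
  comm₁ := f.hom.naturality _
  comm₂ := f.hom.naturality _
  comm₃ := periodicity_naturality f _

end Basic

section Preadditive

variable {C : Type u} [Category.{v} C] [HasShift C ℤ] [Preadditive C]
  [∀ n : ℤ, (shiftFunctor C n).Additive] {n : ℕ} (X Y : HigherTriangle C n)

instance : Zero (X ⟶ Y) where
  zero := ⟨0, fun p => by simp⟩

instance : Add (X ⟶ Y) where
  add f g := ⟨f.hom + g.hom, fun p => by simp [f.comm, g.comm, Functor.map_add]⟩

instance : Neg (X ⟶ Y) where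
  neg f := ⟨-f.hom, fun p => by simp [f.comm, Functor.map_neg]⟩

instance : Sub (X ⟶ Y) where
  sub f g := ⟨f.hom - g.hom, fun p => by simp [f.comm, g.comm, Functor.map_sub]⟩

instance : SMul ℕ (X ⟶ Y) where
  smul k f := ⟨k • f.hom, fun p => by
    simp [f.comm]⟩

instance : SMul ℤ (X ⟶ Y) where
  smul k f := ⟨k • f.hom, fun p => by
    simp [f.comm]⟩

instance : AddCommGroup (X ⟶ Y) :=
  Function.Injective.addCommGroup (fun f : X ⟶ Y => f.hom) (fun _ _ => hom_ext) rfl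
    (fun _ _ => rfl) (fun _ => rfl) (fun _ _ => rfl) (fun _ _ => rfl) (fun _ _ => rfl)

instance : Preadditive (HigherTriangle C n) where
  add_comp _ _ _ _ _ _ := hom_ext (Preadditive.add_comp _ _ _ _ _ _)
  comp_add _ _ _ _ _ _ := hom_ext (Preadditive.comp_add _ _ _ _ _ _)

instance : (base (C := C) n).Additive where
  map_add := rfl

omit [∀ n : ℤ, (shiftFunctor C n).Additive] in
-- Split the idempotent on diagrams. Since it commutes with the periodicity isomorphism, the latter
-- restricts to the summand.
theorem isIdempotentComplete [IsIdempotentComplete C] :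
    IsIdempotentComplete (HigherTriangle C n) where
  idempotents_split X e he := by
    obtain ⟨D, i, p, hip, hpi⟩ := IsIdempotentComplete.idempotents_split X.diagram e.hom
      (congrArg Hom.hom he)
    have hip' (q) : i.app q ≫ p.app q = 𝟙 _ := congr_app hip q
    have hpi' (q) : p.app q ≫ i.app q = e.hom.app q := congr_app hpi q
    have zero (q) (h : IsZero (X.diagram.obj q)) : IsZero (D.obj q) := by
      rw [IsZero.iff_id_eq_zero, ← hip' q, h.eq_of_tgt (i.app q) 0, zero_comp]
    have hi (q) : i.app q ≫ e.hom.app q = i.app q := by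
      rw [← hpi', reassoc_of% hip']
    have hp (q) : e.hom.app q ≫ p.app q = p.app q := by
      rw [← hpi', Category.assoc, hip', Category.comp_id]
    have c₁ (q) : i.app ((TriIndex.rot n).obj q) ≫ X.periodicity.hom.app q ≫
        (e.hom.app q)⟦(1 : ℤ)⟧' =
        i.app ((TriIndex.rot n).obj q) ≫ X.periodicity.hom.app q := by
      rw [← e.comm, reassoc_of% hi]
    have c₂ (q) : e.hom.app ((TriIndex.rot n).obj q) ≫ X.periodicity.hom.app q ≫
        (p.app q)⟦(1 : ℤ)⟧' = X.periodicity.hom.app q ≫ (p.app q)⟦(1 : ℤ)⟧' := by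
      rw [reassoc_of% e.comm, ← Functor.map_comp, hp]
    let π : TriIndex.rot n ⋙ D ≅ D ⋙ shiftFunctor C (1 : ℤ) :=
      { hom := Functor.whiskerLeft (TriIndex.rot n) i ≫ X.periodicity.hom ≫
          Functor.whiskerRight p _
        inv := Functor.whiskerRight i _ ≫ X.periodicity.inv ≫
          Functor.whiskerLeft (TriIndex.rot n) p
        hom_inv_id := by
          ext q
          have c₃ : X.periodicity.hom.app q ≫ (e.hom.app q)⟦(1 : ℤ)⟧' ≫ X.periodicity.inv.app q =
              e.hom.app ((TriIndex.rot n).obj q) := by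
            rw [← reassoc_of% e.comm, Iso.hom_inv_id_app]
            exact Category.comp_id _
          have c₄ : i.app ((TriIndex.rot n).obj q) ≫ X.periodicity.hom.app q ≫
              (p.app q)⟦(1 : ℤ)⟧' ≫ (i.app q)⟦(1 : ℤ)⟧' ≫ X.periodicity.inv.app q ≫
                p.app ((TriIndex.rot n).obj q) = 𝟙 _ := by
            rw [← Functor.map_comp_assoc, hpi', reassoc_of% c₃, reassoc_of% hi, hip']
          simpa using c₄
        inv_hom_id := by
          ext q
          have c₄ : (i.app q)⟦(1 : ℤ)⟧' ≫ X.periodicity.inv.app q ≫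
              p.app ((TriIndex.rot n).obj q) ≫ i.app ((TriIndex.rot n).obj q) ≫
                X.periodicity.hom.app q ≫ (p.app q)⟦(1 : ℤ)⟧' = 𝟙 _ := by
            rw [reassoc_of% hpi', c₂, Iso.inv_hom_id_app_assoc, ← Functor.map_comp, hip',
              CategoryTheory.Functor.map_id]
          simpa using c₄ }
    refine ⟨⟨D, fun q h => zero q (X.isZero_left q h), fun q h => zero q (X.isZero_right q h), π⟩,
      ⟨i, fun q => ?_⟩, ⟨p, fun q => ?_⟩, hom_ext hip, hom_ext hpi⟩
    · refine Eq.trans ?_ (Category.assoc (i.app ((TriIndex.rot n).obj q)) (X.periodicity.hom.app q ≫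
        (p.app q)⟦(1 : ℤ)⟧') _).symm
      rw [Category.assoc, ← Functor.map_comp, hpi', c₁]
    · change p.app ((TriIndex.rot n).obj q) ≫ i.app ((TriIndex.rot n).obj q) ≫
        X.periodicity.hom.app q ≫ (p.app q)⟦(1 : ℤ)⟧' = _
      rw [reassoc_of% hpi', c₂]

/-- Periodicity conjugates the component at the rotated index into the shift of the component at p,
and the shift is faithful. -/
theorem app_rot_sq_eq_zero_iff {X : HigherTriangle C n}
    (d : X ⟶ X) (p : TriIndex n) :
    d.hom.app ((TriIndex.rot n).obj p) ≫ d.hom.app ((TriIndex.rot n).obj p) = 0 ↔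
      d.hom.app p ≫ d.hom.app p = 0 := by
  have h : (d.hom.app ((TriIndex.rot n).obj p) ≫ d.hom.app ((TriIndex.rot n).obj p)) ≫
      X.periodicity.hom.app p = X.periodicity.hom.app p ≫ (d.hom.app p ≫ d.hom.app p)⟦(1 : ℤ)⟧' := by
    rw [Category.assoc, d.comm, reassoc_of% d.comm p, Functor.map_comp]
  constructor
  · intro h₀
    rw [h₀, zero_comp] at h
    have h₁ := (cancel_epi (X.periodicity.hom.app p)).1 (h.symm.trans comp_zero.symm)
    refine (shiftFunctor C (1 : ℤ)).map_injective ?_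
    rw [Functor.map_zero]
    exact h₁
  · intro h₀
    rw [h₀, Functor.map_zero, comp_zero] at h
    exact (cancel_mono (X.periodicity.hom.app p)).1 (h.trans zero_comp.symm)

omit [∀ n : ℤ, (shiftFunctor C n).Additive] in
-- Besides the base, the row i = 0 contains only the zero objects at its two ends.
theorem base_map_eq_zero_iff {X Y : HigherTriangle C (n + 1)} (d : X ⟶ Y) :
    (HigherTriangle.base n).map d = 0 ↔
      ∀ p : TriIndex (n + 1), p.1.1 = 0 → d.hom.app p = 0 := by
  constructor
  · rintro h ⟨⟨i, j⟩, hp⟩ (rfl : i = 0)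
    dsimp at hp
    by_cases h₀ : j = 0
    · exact (X.isZero_left _ h₀).eq_of_src _ _
    by_cases h₁ : j = n + 2
    · exact (X.isZero_right _ (by dsimp; omega)).eq_of_src _ _
    obtain ⟨k, rfl⟩ : ∃ k : ℕ, j = (k : ℤ) + 1 := ⟨(j - 1).toNat, by omega⟩
    exact congr_app h ⟨k, by omega⟩
  · intro h
    ext k
    exact h _ rfl

end Preadditive

section MapFunctor

variable {C : Type u} [Category.{v} C] [HasShift C ℤ] [HasZeroMorphisms C]
  {D : Type u'} [Category.{v'} D] [HasShift D ℤ] [HasZeroMorphisms D] {n : ℕ}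
  (F : C ⥤ D) [F.CommShift ℤ] [F.PreservesZeroMorphisms]

theorem mapFunctor_periodicity_app (X : HigherTriangle C n) (p : TriIndex n) :
    (X.mapFunctor F).periodicity.hom.app p =
      F.map (X.periodicity.hom.app p) ≫ (F.commShiftIso (1 : ℤ)).hom.app (X.diagram.obj p) := by
  refine (Category.id_comp _).trans ?_
  refine congrArg (F.map (X.periodicity.hom.app p) ≫ ·) ?_
  refine (Category.id_comp _).trans (Category.comp_id _)

/-- The image of `n`-triangles under `F`, as a functor. -/
def mapHigherTriangle (n : ℕ) : HigherTriangle C n ⥤ HigherTriangle D n where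
  obj X := X.mapFunctor F
  map {X Y} f :=
    { hom := Functor.whiskerRight f.hom F
      comm p := by
        rw [mapFunctor_periodicity_app, mapFunctor_periodicity_app]
        change F.map (f.hom.app _) ≫ F.map _ ≫ _ =
          (F.map _ ≫ _) ≫ (F.map (f.hom.app p))⟦(1 : ℤ)⟧'
        rw [← F.map_comp_assoc, f.comm, Category.assoc]
        erw [← F.commShiftIso_hom_naturality (f.hom.app p) 1]
        rw [F.map_comp_assoc] }
  map_id X := hom_ext (Functor.whiskerRight_id _)
  map_comp f g := hom_ext (Functor.whiskerRight_comp _ _ _)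

instance [F.Faithful] : (mapHigherTriangle F n).Faithful where
  map_injective {X Y f g} h := by
    ext p
    exact F.map_injective (congr_app (congrArg Hom.hom h) p)

/-- Functors commute with faces, degeneracies and translations. -/
def mapPullbackIso {m : ℕ} (X : HigherTriangle C n) (φ : PeriodicMap m n) :
    (X.pullback φ).mapFunctor F ≅ (X.mapFunctor F).pullback φ :=
  isoMk (Iso.refl _) (fun p => by
    refine (Category.id_comp _).trans (Eq.trans ?_
      (comp_shift_map_id _).symm)
    rw [mapFunctor_periodicity_app F (X.pullback φ) p]
    change F.map (X.diagram.map (eqToHom (φ.index_rot p))) ≫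
        (X.mapFunctor F).periodicity.hom.app (φ.index.obj p) =
      F.map (X.diagram.map (eqToHom (φ.index_rot p)) ≫ X.periodicity.hom.app (φ.index.obj p)) ≫
        (F.commShiftIso (1 : ℤ)).hom.app (X.diagram.obj (φ.index.obj p))
    rw [mapFunctor_periodicity_app, F.map_comp_assoc]
    rfl)

/-- The triangle of the image of a `2`-triangle. -/
def mapToTriangleIso (X : HigherTriangle C 2) :
    (X.mapFunctor F).toTriangle ≅ F.mapTriangle.obj X.toTriangle :=
  Triangle.isoMk _ _ (Iso.refl _) (Iso.refl _) (Iso.refl _)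
    ((Category.comp_id _).trans (Category.id_comp _).symm)
    ((Category.comp_id _).trans (Category.id_comp _).symm)
    (by
      refine (comp_shift_map_id _).trans (Eq.trans ?_ (Category.id_comp _).symm)
      refine (congrArg (F.map (X.diagram.map _) ≫ ·) (mapFunctor_periodicity_app F X _)).trans ?_
      exact (F.map_comp_assoc _ _ _).symm)

end MapFunctor

section MapFunctorAdditive

variable {C : Type u} [Category.{v} C] [HasShift C ℤ] [Preadditive C]
  [∀ n : ℤ, (shiftFunctor C n).Additive]
  {D : Type u'} [Category.{v'} D] [HasShift D ℤ] [Preadditive D]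
  [∀ n : ℤ, (shiftFunctor D n).Additive] {n : ℕ} (F : C ⥤ D) [F.CommShift ℤ] [F.Additive]

instance : (mapHigherTriangle F n).Additive where
  map_add {X Y f g} := by
    ext p
    exact F.map_add

end MapFunctorAdditive

end HigherTriangle

/-! ### Triangulations of order N: square-zero property and octahedra -/

/-- The periodic map with values `a ≤ b ≤ c` at `0`, `1`, `2`. -/
@[simps]
def PeriodicMap.ofTriple (n : ℕ) (a b c : ℤ) (hab : a ≤ b) (hbc : b ≤ c) (hca : c ≤ a + n + 1) :
    PeriodicMap 2 n where
  toFun k := k / 3 * (n + 1) + (if k % 3 = 0 then a else if k % 3 = 1 then b else c)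
  mono := monotone_int_of_le_succ (fun k => by
    obtain ⟨q, r, h₀, h₁, rfl⟩ : ∃ q r : ℤ, 0 ≤ r ∧ r < 3 ∧ k = 3 * q + r :=
      ⟨k / 3, k % 3, by omega, by omega, by omega⟩
    obtain rfl | rfl | rfl : r = 0 ∨ r = 1 ∨ r = 2 := by omega
    · rw [show (3 * q + 0) / 3 = q by omega, show (3 * q + 0) % 3 = 0 by omega,
        show (3 * q + 0 + 1) / 3 = q by omega, show (3 * q + 0 + 1) % 3 = 1 by omega]
      simpa using hab
    · rw [show (3 * q + 1) / 3 = q by omega, show (3 * q + 1) % 3 = 1 by omega,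
        show (3 * q + 1 + 1) / 3 = q by omega, show (3 * q + 1 + 1) % 3 = 2 by omega]
      simpa using hbc
    · rw [show (3 * q + 2) / 3 = q by omega, show (3 * q + 2) % 3 = 2 by omega,
        show (3 * q + 2 + 1) / 3 = q + 1 by omega, show (3 * q + 2 + 1) % 3 = 0 by omega]
      simp only [add_mul, if_true]
      norm_num
      linarith)
  period k := by
    rw [show (k + (2 : ℕ) + 1) / 3 = k / 3 + 1 by push_cast; omega,
      show (k + (2 : ℕ) + 1) % 3 = k % 3 by push_cast; omega]
    ring

namespace HigherTriangulation

variable {C : Type u} [Category.{v} C] [HasZeroObject C] [HasShift C ℤ] [Preadditive C]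
  [∀ n : ℤ, (shiftFunctor C n).Additive] [Pretriangulated C] {N : ℕ∞}
  (H : HigherTriangulation C N)

include H in
-- The object X i j is the third vertex of the 2-triangle face at 0 ≤ i ≤ j, whose first two
-- vertices X 0 i and X 0 j lie in the row where d vanishes. So the claim for triangles applies, and
-- periodicity moves every index to such a pair.
theorem sq_eq_zero (hN : 2 ≤ N) {n : ℕ} (hn : ((n + 1 : ℕ) : ℕ∞) ≤ N)
    {X : HigherTriangle C (n + 1)} (hX : H.dist _ X) (d : X ⟶ X)
    (hd : (HigherTriangle.base n).map d = 0) : d ≫ d = 0 := by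
  rw [HigherTriangle.base_map_eq_zero_iff] at hd
  have fundamental (i j : ℤ) (h₀ : 0 ≤ i) (hij : i ≤ j) (hj : j ≤ n + 2) (hp) :
      d.hom.app ⟨(i, j), hp⟩ ≫ d.hom.app ⟨(i, j), hp⟩ = 0 := by
    let φ := PeriodicMap.ofTriple (n + 1) 0 i j h₀ hij (by push_cast; omega)
    have hφ : φ.index.obj ⟨(1, 2), by norm_num⟩ = ⟨(i, j), hp⟩ := by
      ext
      · change φ.toFun 1 = i
        simp [φ]
      · change φ.toFun 2 = j
        simp [φ]
    have hφ₀ : φ.toFun 0 = 0 := by simp [φ]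
    have hT := (H.dist_two hN _).1 (H.pullback 2 (n + 1) hN hn φ X hX)
    have := isTriangleLike_triangleBase.squareZero hT
      (HigherTriangle.toTriangleMap (HigherTriangle.pullbackMap φ d))
      ((triangleBase_map_eq_zero_iff _).2 ⟨hd _ hφ₀, hd _ hφ₀⟩)
    have h₃ : d.hom.app (φ.index.obj ⟨(1, 2), by norm_num⟩) ≫
        d.hom.app (φ.index.obj ⟨(1, 2), by norm_num⟩) = 0 := congrArg TriangleMorphism.hom₃ this
    rwa [hφ] at h₃
  let Q (i j : ℤ) : Prop := ∀ hp, d.hom.app ⟨(i, j), hp⟩ ≫ d.hom.app ⟨(i, j), hp⟩ = 0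
  -- With m = n + 2, rotation sends (i, j) to (j, i + m) and its square translates by m. Translation
  -- reduces to 0 ≤ i < m; if then j > m, the inverse rotation (j - m, i) lies in the range already
  -- treated.
  obtain ⟨m, hm⟩ : ∃ m : ℤ, m = ((n + 1 : ℕ) : ℤ) + 1 := ⟨_, rfl⟩
  have rot (i j : ℤ) : Q i j ↔ Q j (i + m) := by
    subst hm
    constructor
    · intro h hp
      have hp' : i ≤ j ∧ j ≤ i + (n + 1 : ℕ) + 1 := by dsimp at hp; omega
      have e : (TriIndex.rot (n + 1)).obj ⟨(i, j), hp'⟩ = ⟨_, hp⟩ :=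
        Subtype.ext (Prod.ext rfl (add_assoc _ _ _))
      rw [← e]
      exact (HigherTriangle.app_rot_sq_eq_zero_iff d _).2 (h hp')
    · intro h hp
      have e : (TriIndex.rot (n + 1)).obj ⟨(i, j), hp⟩ = ⟨(j, i + (((n + 1 : ℕ) : ℤ) + 1)),
          by dsimp at hp ⊢; omega⟩ := Subtype.ext (Prod.ext rfl (add_assoc _ _ _))
      refine (HigherTriangle.app_rot_sq_eq_zero_iff d _).1 ?_
      rw [e]
      exact h _
  have step (i j : ℤ) : Q i j ↔ Q (i + m) (j + m) := (rot i j).trans (rot j (i + m))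
  have trans (k : ℤ) (i j : ℤ) : Q i j ↔ Q (i + k * m) (j + k * m) := by
    induction k using Int.induction_on with
    | zero => simp
    | succ k ih =>
      rw [ih, step]
      ring_nf
    | pred k ih =>
      rw [ih, step (i + (-k - 1) * m)]
      ring_nf
  have strip (i j : ℤ) (h₀ : 0 ≤ i) (hi : i < m) : Q i j := by
    intro hp
    by_cases hj : j ≤ n + 2
    · exact fundamental i j h₀ hp.1 hj hp
    · have := (rot (j - m) i).1 (fun hp' => fundamental _ _ (by dsimp at hp; omega)
        (by dsimp at hp; omega) (by omega) hp')
      rw [sub_add_cancel] at this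
      exact this hp
  have hm' : m ≠ 0 := by omega
  have all (i j : ℤ) : Q i j := by
    refine (trans (-(i / m)) i j).2 (strip _ _ ?_ ?_)
    · have := Int.emod_nonneg i hm'
      rw [Int.emod_def] at this
      linarith
    · have := Int.emod_lt_of_pos i (b := m) (by omega)
      rw [Int.emod_def] at this
      linarith
  ext ⟨⟨i, j⟩, hp⟩
  exact all i j hp

end HigherTriangulation

namespace HigherTriangulation

variable {C : Type u} [Category.{v} C] [HasZeroObject C] [HasShift C ℤ] [Preadditive C]
  [∀ n : ℤ, (shiftFunctor C n).Additive] [Pretriangulated C] {N : ℕ∞}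

theorem isTriangleLike (H : HigherTriangulation C N) (hN : 2 ≤ N) {n : ℕ}
    (hn : ((n + 1 : ℕ) : ℕ∞) ≤ N) :
    IsTriangleLike (HigherTriangle.base (C := C) n) (H.dist (n + 1)) where
  of_iso e h := H.of_iso _ hn _ _ ⟨e⟩ h
  squareZero h d hd := H.sq_eq_zero hN hn h d hd
  exists_map_eq hX hY f := H.exists_hom n hn _ _ hX hY f
  exists_obj_iso Z := H.exists_of_base n hn Z

/-- All `0`-triangles are distinguished. -/
theorem dist_zero (H : HigherTriangulation C N) (hN : 1 ≤ N) (X : HigherTriangle C 0) :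
    H.dist 0 X := by
  obtain ⟨X₀, -⟩ := HasZeroObject.zero (C := C)
  obtain ⟨Y, hY, -⟩ := H.exists_of_base 0 (by simpa using hN) (ComposableArrows.mk₀ X₀)
  -- A 0-triangle has no base, so one is obtained from a distinguished 1-triangle. The periods are 1
  -- and 2, hence the doubling map. All 0-triangles vanish and are thus isomorphic.
  let φ : PeriodicMap 0 1 :=
    { toFun k := 2 * k
      mono := fun a b h => by dsimp; omega
      period := fun i => by dsimp; ring }
  have zero (Z : HigherTriangle C 0) (p) : IsZero (Z.diagram.obj p) := by
    obtain h | h : p.1.2 = p.1.1 ∨ p.1.2 = p.1.1 + (0 : ℕ) + 1 := by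
      have := p.2
      push_cast at *
      omega
    · exact Z.isZero_left p h
    · exact Z.isZero_right p h
  refine H.of_iso 0 (by simp) (Y.pullback φ) X ⟨HigherTriangle.isoMk
    (NatIso.ofComponents (fun p => (zero _ p).iso (zero _ p))
      (fun _ => (zero _ _).eq_of_src _ _)) (fun p => (zero _ _).eq_of_src _ _)⟩
    (H.pullback 0 1 (by simp) (by simpa using hN) φ Y hY)

omit [HasZeroObject C] [Preadditive C] [∀ n : ℤ, (shiftFunctor C n).Additive]
  [Pretriangulated C] in
/-- The triangle `X p ⟶ X q ⟶ X r ⟶ X (rot p) ≅ (X p)⟦1⟧`. -/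
def _root_.SepExt.HigherTriangle.triangle {n : ℕ} (X : HigherTriangle C n) {p q r : TriIndex n}
    (hpq : p ≤ q) (hqr : q ≤ r) (hrp : r ≤ (TriIndex.rot n).obj p) : Triangle C :=
  Triangle.mk (X.diagram.map (homOfLE hpq)) (X.diagram.map (homOfLE hqr))
    (X.diagram.map (homOfLE hrp) ≫ X.periodicity.hom.app p)

omit [HasZeroObject C] [Preadditive C] [∀ n : ℤ, (shiftFunctor C n).Additive]
  [Pretriangulated C] in
theorem _root_.SepExt.HigherTriangle.triangle_mor₃_comp {n : ℕ} (X : HigherTriangle C n)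
    {p q r : TriIndex n} (hqp : q ≤ (TriIndex.rot n).obj p) (hpr : p ≤ r) :
    (X.diagram.map (homOfLE hqp) ≫ X.periodicity.hom.app p) ≫
      (X.diagram.map (homOfLE hpr))⟦(1 : ℤ)⟧' =
        X.diagram.map (homOfLE (hqp.trans ((TriIndex.rot n).map (homOfLE hpr)).le)) ≫
          X.periodicity.hom.app r := by
  have h := X.periodicity.hom.naturality (homOfLE hpr)
  rw [Category.assoc]
  refine (congrArg (X.diagram.map (homOfLE hqp) ≫ ·) h).symm.trans ?_
  rw [← Category.assoc]
  exact congrArg (· ≫ _) (X.diagram.map_comp _ _).symm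

/-- This is the face at a ≤ b ≤ c. The vertices are given with equations so that they can be literal
pairs rather than values of a periodic map. -/
theorem triangle_mem (H : HigherTriangulation C N) (hN : 2 ≤ N) {n : ℕ} (hn : (n : ℕ∞) ≤ N)
    {X : HigherTriangle C n} (hX : H.dist n X) {a b c : ℤ} (hab : a ≤ b) (hbc : b ≤ c)
    (hca : c ≤ a + n + 1) {p q r : TriIndex n} (hp : p.1 = (a, b)) (hq : q.1 = (a, c))
    (hr : r.1 = (b, c)) (hpq : p ≤ q) (hqr : q ≤ r) (hrp : r ≤ (TriIndex.rot n).obj p) :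
    X.triangle hpq hqr hrp ∈ distTriang C := by
  let φ := PeriodicMap.ofTriple n a b c hab hbc hca
  have hφ₀ : φ.toFun 0 = a := by simp [φ]
  have hφ₁ : φ.toFun 1 = b := by simp [φ]
  have hφ₂ : φ.toFun 2 = c := by simp [φ]
  obtain rfl : p = φ.index.obj ⟨(0, 1), by norm_num⟩ :=
    Subtype.ext (hp.trans (Prod.ext hφ₀ hφ₁).symm)
  obtain rfl : q = φ.index.obj ⟨(0, 2), by norm_num⟩ :=
    Subtype.ext (hq.trans (Prod.ext hφ₀ hφ₂).symm)
  obtain rfl : r = φ.index.obj ⟨(1, 2), by norm_num⟩ :=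
    Subtype.ext (hr.trans (Prod.ext hφ₁ hφ₂).symm)
  have := (H.dist_two hN _).1 (H.pullback 2 n hN hn φ X hX)
  convert this using 1
  refine congrArg (Triangle.mk (X.diagram.map (homOfLE hpq)) (X.diagram.map (homOfLE hqr))) ?_
  refine Eq.trans ?_ (Category.assoc _ _ _)
  exact congrArg (· ≫ _) (X.diagram.map_comp _ _)

/-- A triangulation of order at least `3` gives octahedra. -/
theorem isTriangulated (H : HigherTriangulation C N) (hN : 3 ≤ N) : IsTriangulated C := by
  have h2 : 2 ≤ N := le_trans (by norm_num) hN
  refine IsTriangulated.mk' (fun X₁ X₂ X₃ u₁₂ u₂₃ => ?_)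
  obtain ⟨X, hX, ⟨e⟩⟩ := H.exists_of_base 2 (by simpa using hN) (ComposableArrows.mk₂ u₁₂ u₂₃)
  let p₀₁ : TriIndex 3 := ⟨(0, 1), by norm_num⟩
  let p₀₂ : TriIndex 3 := ⟨(0, 2), by norm_num⟩
  let p₀₃ : TriIndex 3 := ⟨(0, 3), by norm_num⟩
  let p₁₂ : TriIndex 3 := ⟨(1, 2), by norm_num⟩
  let p₁₃ : TriIndex 3 := ⟨(1, 3), by norm_num⟩
  let p₂₃ : TriIndex 3 := ⟨(2, 3), by norm_num⟩
  have l₁ : p₀₁ ≤ p₀₂ := ⟨by norm_num [p₀₁, p₀₂], by norm_num [p₀₁, p₀₂]⟩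
  have l₂ : p₀₂ ≤ p₀₃ := ⟨by norm_num [p₀₃, p₀₂], by norm_num [p₀₃, p₀₂]⟩
  have l₃ : p₀₂ ≤ p₁₂ := ⟨by norm_num [p₁₂, p₀₂], by norm_num [p₁₂, p₀₂]⟩
  have l₄ : p₀₃ ≤ p₁₃ := ⟨by norm_num [p₁₃, p₀₃], by norm_num [p₁₃, p₀₃]⟩
  have l₅ : p₁₂ ≤ p₁₃ := ⟨by norm_num [p₁₃, p₁₂], by norm_num [p₁₃, p₁₂]⟩
  have l₆ : p₁₃ ≤ p₂₃ := ⟨by norm_num [p₁₃, p₂₃], by norm_num [p₁₃, p₂₃]⟩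
  have m₁ : p₁₃ ≤ (TriIndex.rot 3).obj p₀₁ :=
    ⟨show (1 : ℤ) ≤ 1 by norm_num, show (3 : ℤ) ≤ 0 + (3 : ℕ) + 1 by norm_num⟩
  have m₂ : p₂₃ ≤ (TriIndex.rot 3).obj p₀₂ :=
    ⟨show (2 : ℤ) ≤ 2 by norm_num, show (3 : ℤ) ≤ 0 + (3 : ℕ) + 1 by norm_num⟩
  have m₃ : p₂₃ ≤ (TriIndex.rot 3).obj p₁₂ :=
    ⟨show (2 : ℤ) ≤ 2 by norm_num, show (3 : ℤ) ≤ 1 + (3 : ℕ) + 1 by norm_num⟩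
  have h3 : ((3 : ℕ) : ℕ∞) ≤ N := hN
  have comp {p q r : TriIndex 3} (h : p ≤ q) (h' : q ≤ r) :
      X.diagram.map (homOfLE h) ≫ X.diagram.map (homOfLE h') =
        X.diagram.map (homOfLE (h.trans h')) := (X.diagram.map_comp _ _).symm
  -- The four triangles of the octahedron are the faces of X that omit one of the vertices 0, 1, 2,
  -- 3.
  have h₁₂ : X.triangle l₁ l₃ (l₅.trans m₁) ∈ distTriang C :=
    H.triangle_mem h2 h3 hX (a := 0) (b := 1) (c := 2) (by norm_num) (by norm_num) (by norm_num)
      rfl rfl rfl l₁ l₃ (l₅.trans m₁)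
  have h₂₃ : X.triangle l₂ (l₄.trans l₆) m₂ ∈ distTriang C :=
    H.triangle_mem h2 h3 hX (a := 0) (b := 2) (c := 3) (by norm_num) (by norm_num) (by norm_num)
      rfl rfl rfl l₂ (l₄.trans l₆) m₂
  have h₁₃ : X.triangle (l₁.trans l₂) l₄ m₁ ∈ distTriang C :=
    H.triangle_mem h2 h3 hX (a := 0) (b := 1) (c := 3) (by norm_num) (by norm_num) (by norm_num)
      rfl rfl rfl (l₁.trans l₂) l₄ m₁
  have hmem : X.triangle l₅ l₆ m₃ ∈ distTriang C :=
    H.triangle_mem h2 h3 hX (a := 1) (b := 2) (c := 3) (by norm_num) (by norm_num) (by norm_num)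
      rfl rfl rfl l₅ l₆ m₃
  refine ⟨_, _, _, _, _, _, X.diagram.map (homOfLE l₁), X.diagram.map (homOfLE l₂),
    (e.app 0).symm, (e.app 1).symm, (e.app 2).symm,
    e.inv.naturality (homOfLE (show (0 : Fin 3) ≤ 1 by simp)),
    e.inv.naturality (homOfLE (show (1 : Fin 3) ≤ 2 by decide)),
    X.diagram.map (homOfLE l₃), X.diagram.map (homOfLE (l₅.trans m₁)) ≫ X.periodicity.hom.app p₀₁,
    h₁₂, X.diagram.map (homOfLE (l₄.trans l₆)), X.diagram.map (homOfLE m₂) ≫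
      X.periodicity.hom.app p₀₂, h₂₃, X.diagram.map (homOfLE l₄), X.diagram.map (homOfLE m₁) ≫
      X.periodicity.hom.app p₀₁, ?_, ⟨X.diagram.map (homOfLE l₅), X.diagram.map (homOfLE l₆),
      ?_, ?_, ?_, ?_, ?_⟩⟩
  · rw [comp]
    exact h₁₃
  · rw [comp, comp]
  · rw [← Category.assoc, comp]
  · rw [comp]
  · rw [← Category.assoc, comp]
    exact X.triangle_mor₃_comp m₁ l₁
  · rw [X.triangle_mor₃_comp m₂ l₃]
    exact hmem

end HigherTriangulation

/-! ### Higher triangles of modules -/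

section ModuleTriangles

variable {C : Type u} [Category.{v} C] [HasShift C ℤ]
  {A : CategoryTheory.Monad C} [A.toFunctor.CommShift ℤ]
  [NatTrans.CommShift A.η ℤ] [NatTrans.CommShift A.μ ℤ] [Preadditive C] [A.toFunctor.Additive]

theorem mapFunctor_forget_periodicity_app {n : ℕ} (X : HigherTriangle A.Algebra n)
    (p : TriIndex n) :
    (X.mapFunctor A.forget).periodicity.hom.app p = (X.periodicity.hom.app p).f :=
  (HigherTriangle.mapFunctor_periodicity_app A.forget X p).trans (Category.comp_id _)

/-- The triangle underlying a free triangle. -/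
def mapFreeForgetIso {n : ℕ} (X : HigherTriangle C n) :
    (X.mapFunctor A.free).mapFunctor A.forget ≅ X.mapFunctor A.toFunctor :=
  HigherTriangle.isoMk (Iso.refl _) (fun p => by
    refine (Category.id_comp _).trans (Eq.trans ?_ (comp_shift_map_id _).symm)
    refine Eq.trans ?_ (mapFunctor_forget_periodicity_app (X.mapFunctor A.free) p).symm
    rw [HigherTriangle.mapFunctor_periodicity_app A.free X p]
    exact HigherTriangle.mapFunctor_periodicity_app A.toFunctor X p)

/-- Averaging of morphisms between the underlying `n`-triangles of modules. -/
def Averaging.avgHom (α : Averaging A) {n : ℕ} {X Y : HigherTriangle A.Algebra n}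
    (g : X.mapFunctor A.forget ⟶ Y.mapFunctor A.forget) : X ⟶ Y where
  hom :=
    { app p := α.avg (g.hom.app p)
      naturality p q u := by
        refine (α.avg_precomp _ _).symm.trans (Eq.trans ?_ (α.avg_postcomp _ _))
        exact congrArg α.avg (g.hom.naturality u) }
  comm p := by
    refine (α.avg_postcomp _ _).symm.trans (Eq.trans ?_ ((α.avg_precomp _ _).trans
      (congrArg (X.periodicity.hom.app p ≫ ·) (α.avg_shift (g.hom.app p)))))
    have h := g.comm p
    rw [mapFunctor_forget_periodicity_app, mapFunctor_forget_periodicity_app] at h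
    exact congrArg α.avg h

/-- A diagram of modules is a retract of a diagram of free modules. -/
def Averaging.retractDiagram (α : Averaging A) {J : Type*} [Category* J] (Z : J ⥤ A.Algebra) :
    Retract Z ((Z ⋙ A.forget) ⋙ A.free) where
  i := { app := fun k => (α.retract (Z.obj k)).i
         naturality := fun _ _ u => α.retract_i_naturality (Z.map u) }
  r := { app := fun k => (α.retract (Z.obj k)).r
         naturality := fun _ _ u => (α.retract_r_naturality (Z.map u)).symm }
  retract := by
    ext k : 2
    exact (α.retract (Z.obj k)).retract

end ModuleTriangles

section ModuleTriangulation

variable {C : Type u} [Category.{v} C] [HasZeroObject C] [HasShift C ℤ] [Preadditive C]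
  [∀ n : ℤ, (shiftFunctor C n).Additive] [Pretriangulated C]
  {A : CategoryTheory.Monad C} [A.toFunctor.CommShift ℤ] [A.toFunctor.IsTriangulated]
  [NatTrans.CommShift A.η ℤ] [NatTrans.CommShift A.μ ℤ] [IsIdempotentComplete C]
  (α : Averaging A) {N : ℕ∞} (H : HigherTriangulation C N)
  (hA : IsExactOfOrder A.toFunctor H H)

include α hA in
-- As for triangles: morphisms of bases are extended on underlying n-triangles and averaged, and a
-- base of modules is a retract of the base of a free n-triangle, which is distinguished by
-- exactness of the monad.
theorem isTriangleLike_modHigher (hN : 2 ≤ N) {n : ℕ} (hn : ((n + 1 : ℕ) : ℕ∞) ≤ N) :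
    IsTriangleLike (HigherTriangle.base (C := A.Algebra) n)
      (fun X => H.dist (n + 1) (X.mapFunctor A.forget)) := by
  have := isIdempotentComplete_algebra A
  have := HigherTriangle.isIdempotentComplete (C := A.Algebra) (n := n + 1)
  refine (H.isTriangleLike hN hn).inverseImage
    (HigherTriangle.mapHigherTriangle A.forget (n + 1)) ?_ ?_ ?_
  · intro X d hd
    ext k
    exact congrArg Monad.Algebra.Hom.f (congr_app hd k)
  · intro X Y hX hY f
    obtain ⟨g, hg⟩ := (H.isTriangleLike hN hn).exists_map_eq hX hY
      (Functor.whiskerRight f A.forget)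
    refine ⟨α.avgHom g, ?_⟩
    ext k : 2
    exact (congrArg α.avg (congr_app hg k)).trans (α.avg_f (f.app k))
  · intro Z
    obtain ⟨X, hX, ⟨e⟩⟩ := H.exists_of_base n hn (Z ⋙ A.forget)
    refine ⟨X.mapFunctor A.free, H.of_iso _ hn _ _ ⟨(mapFreeForgetIso X).symm⟩ (hA _ hn _ hX),
      ⟨(α.retractDiagram Z).trans (Retract.ofIso (Functor.isoWhiskerRight e.symm A.free))⟩⟩

/-- The triangulation of order `N` of the category of modules: an `n`-triangle of modules is
distinguished when its underlying `n`-triangle is. -/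
def modHigherTriangulation (hN : 2 ≤ N) :
    letI := modPretriangulated α
    HigherTriangulation A.Algebra N :=
  letI := modPretriangulated α
  { dist n X := H.dist n (X.mapFunctor A.forget)
    of_iso := fun n hn _ _ ⟨e⟩ h =>
      H.of_iso n hn _ _ ⟨(HigherTriangle.mapHigherTriangle A.forget n).mapIso e⟩ h
    pullback := fun m n hm hn φ X h =>
      H.of_iso m hm _ _ ⟨(HigherTriangle.mapPullbackIso A.forget X φ).symm⟩
        (H.pullback m n hm hn φ _ h)
    exists_of_base := fun _ hn B => (isTriangleLike_modHigher α H hA hN hn).exists_obj_iso B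
    exists_hom := fun _ hn _ _ hX hY f =>
      (isTriangleLike_modHigher α H hA hN hn).exists_map_eq hX hY f
    dist_two := fun h2 X => (H.dist_two h2 _).trans
      (distinguished_iff_of_iso (HigherTriangle.mapToTriangleIso A.forget X)) }

theorem modHigherTriangulation_forget (hN : 2 ≤ N) :
    letI := modPretriangulated α
    IsExactOfOrder A.forget (modHigherTriangulation α H hA hN) H :=
  letI := modPretriangulated α
  fun _ _ _ h => h

theorem modHigherTriangulation_free (hN : 2 ≤ N) :
    letI := modPretriangulated α
    IsExactOfOrder A.free H (modHigherTriangulation α H hA hN) :=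
  letI := modPretriangulated α
  fun n hn X h => H.of_iso n hn _ _ ⟨(mapFreeForgetIso X).symm⟩ (hA n hn X h)

/-- The base determines a distinguished n-triangle up to isomorphism, and `K` realizes every base.
The case n = 0 is separate, there being no base. -/
theorem dist_eq_modHigherTriangulation_dist (hN : 2 ≤ N) :
    letI := modPretriangulated α
    ∀ K : HigherTriangulation A.Algebra N, IsExactOfOrder A.forget K H →
      ∀ n : ℕ, (n : ℕ∞) ≤ N → K.dist n = (modHigherTriangulation α H hA hN).dist n := by
  let := modPretriangulated α
  intro K hK n hn
  have h1 : 1 ≤ N := le_trans (by norm_num) hN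
  ext X
  refine ⟨fun h => hK n hn X h, fun h => ?_⟩
  cases n with
  | zero => exact K.dist_zero h1 X
  | succ n =>
    obtain ⟨Y, hY, ⟨e⟩⟩ := K.exists_of_base n hn ((HigherTriangle.base n).obj X)
    obtain ⟨e'⟩ := (isTriangleLike_modHigher α H hA hN hn).nonempty_iso (hK _ hn Y hY) h e
    exact K.of_iso _ hn _ _ ⟨e'⟩ hY

end ModuleTriangulation

/-! ### Projections of a coproduct onto finite subfamilies -/

section PartialIdentity

open scoped Classical in
/-- The projection of a coproduct onto one of its summands. -/
def cofanProj {C : Type u} [Category.{v} C] [HasZeroMorphisms C] {I : Type v'} {x : I → C}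
    {X : Cofan x} (hX : IsColimit X) (i : I) : X.pt ⟶ x i :=
  Cofan.IsColimit.desc hX fun j => if h : j = i then eqToHom (congrArg x h) else 0

section

variable {C : Type u} [Category.{v} C] [HasZeroMorphisms C] {I : Type v'} {x : I → C}
  {X : Cofan x} (hX : IsColimit X)

@[simp]
theorem inj_cofanProj_self (i : I) : X.inj i ≫ cofanProj hX i = 𝟙 (x i) := by
  simp [cofanProj, Cofan.IsColimit.fac]

theorem inj_cofanProj_of_ne {i j : I} (h : i ≠ j) : X.inj i ≫ cofanProj hX j = 0 := by
  simp [cofanProj, Cofan.IsColimit.fac, h]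

end

variable {C : Type u} [Category.{v} C] [Preadditive C] {I : Type v'} {x : I → C}
  {X : Cofan x} (hX : IsColimit X)

/-- The idempotent endomorphism of a coproduct which projects onto a finite subfamily. -/
def partialId (J : Finset I) : X.pt ⟶ X.pt :=
  ∑ i ∈ J, cofanProj hX i ≫ X.inj i

theorem inj_partialId_of_mem {J : Finset I} {i : I} (hi : i ∈ J) :
    X.inj i ≫ partialId hX J = X.inj i := by
  rw [partialId, Preadditive.comp_sum, Finset.sum_eq_single_of_mem i hi]
  · rw [← Category.assoc, inj_cofanProj_self, Category.id_comp]
  · intro j _ hj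
    rw [← Category.assoc, inj_cofanProj_of_ne hX hj.symm, zero_comp]

theorem partialId_cofanProj_of_notMem {J : Finset I} {i : I} (hi : i ∉ J) :
    partialId hX J ≫ cofanProj hX i = 0 := by
  rw [partialId, Preadditive.sum_comp]
  refine Finset.sum_eq_zero fun j hj => ?_
  rw [Category.assoc, inj_cofanProj_of_ne hX (ne_of_mem_of_not_mem hj hi), comp_zero]

theorem sum_comp_partialId {c : C} (J : Finset I) (g : ∀ i, c ⟶ x i) {J' : Finset I}
    (h : J ⊆ J') :
    (∑ i ∈ J, g i ≫ X.inj i) ≫ partialId hX J' = ∑ i ∈ J, g i ≫ X.inj i := by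
  rw [Preadditive.sum_comp]
  refine Finset.sum_congr rfl fun i hi => ?_
  rw [Category.assoc, inj_partialId_of_mem hX (h hi)]

theorem partialId_comp_of_subset {J J' : Finset I} (h : J ⊆ J') :
    partialId hX J ≫ partialId hX J' = partialId hX J :=
  sum_comp_partialId hX J _ h

theorem comp_partialId_of_subset {c : C} {f : c ⟶ X.pt} {J J' : Finset I}
    (hf : f ≫ partialId hX J = f) (h : J ⊆ J') : f ≫ partialId hX J' = f := by
  rw [← hf, Category.assoc, partialId_comp_of_subset hX h]

/-- The coproduct of a finite subfamily splits off the coproduct of the family. -/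
theorem exists_splitting_partialId (J : Finset I) {Y : Cofan (fun j : J => x j)}
    (hY : IsColimit Y) : ∃ r : X.pt ⟶ Y.pt,
      hY.desc (Cofan.mk X.pt fun j : J => X.inj j) ≫ r = 𝟙 Y.pt ∧
      r ≫ hY.desc (Cofan.mk X.pt fun j : J => X.inj j) = partialId hX J := by
  classical
  refine ⟨∑ j : J, cofanProj hX j ≫ Y.inj j, Cofan.IsColimit.hom_ext hY _ _ fun i => ?_, ?_⟩
  · rw [Cofan.IsColimit.inj_desc_assoc, Category.comp_id, cofan_mk_inj, Preadditive.comp_sum,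
      Finset.sum_eq_single i]
    · rw [← Category.assoc, inj_cofanProj_self, Category.id_comp]
    · intro j _ hj
      rw [← Category.assoc, inj_cofanProj_of_ne hX (fun h => hj (Subtype.ext h.symm)), zero_comp]
    · exact fun h => (h (Finset.mem_univ _)).elim
  · rw [Preadditive.sum_comp, partialId, ← Finset.sum_coe_sort J]
    refine Finset.sum_congr rfl fun j _ => ?_
    rw [Category.assoc]
    exact congrArg (cofanProj hX j.1 ≫ ·) (Cofan.IsColimit.inj_desc _ hY j)

end PartialIdentity

/-! ### Compactness through finite support -/

section Compact

theorem compactObjects_of_retract {C : Type u} [Category.{v} C] {X Y : C} (r : Retract X Y)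
    (hY : compactObjects C Y) : compactObjects C X := by
  intro I x Z hZ f
  obtain ⟨J, W, hW, g, hg⟩ := hY I x Z hZ (r.r ≫ f)
  exact ⟨J, W, hW, r.i ≫ g, by rw [Category.assoc, hg, r.retract_assoc]⟩

instance {C : Type u} [Category.{v} C] : (compactObjects C).IsStableUnderRetracts where
  of_retract := compactObjects_of_retract

/-- The image of a colimit cofan under a functor which commutes with coproducts. -/
def CommutesWithCoproducts.isColimit {C : Type u} [Category.{v} C] {D : Type u'} [Category.{v'} D]
    {F : C ⥤ D}
    (hF : CommutesWithCoproducts F) {I : Type v} {x : I → C} {X : Cofan x} (hX : IsColimit X) :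
    IsColimit (Cofan.mk (F.obj X.pt) fun i => F.map (X.inj i)) :=
  have := (hF I).some
  Cofan.isColimitMapCoconeEquiv F x X (isColimitOfPreserves F hX)

variable {C : Type u} [Category.{v} C] [Preadditive C]

/-- A morphism from a compact object to a coproduct is supported on a finite subfamily. -/
theorem exists_comp_partialId_eq {c : C} (hc : compactObjects C c) {I : Type v} {x : I → C}
    {X : Cofan x} (hX : IsColimit X) (f : c ⟶ X.pt) :
    ∃ J : Finset I, f ≫ partialId hX J = f := by
  obtain ⟨J, Y, hY, g, rfl⟩ := hc I x X hX f
  refine ⟨J, ?_⟩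
  obtain ⟨r, hr, hr'⟩ := exists_splitting_partialId hX J hY
  rw [← hr', Category.assoc, reassoc_of% hr]

/-- A finite sub-coproduct is a direct summand, so factoring through it means being fixed by its
idempotent. In this form supports can be enlarged and united, and additive functors can be applied.
-/
theorem compactObjects_iff [HasFiniteCoproducts C] {c : C} : compactObjects C c ↔
    ∀ (I : Type v) (x : I → C) (X : Cofan x) (hX : IsColimit X) (f : c ⟶ X.pt),
      ∃ J : Finset I, f ≫ partialId hX J = f := by
  refine ⟨fun hc I x X hX f => exists_comp_partialId_eq hc hX f, fun hc I x X hX f => ?_⟩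
  obtain ⟨J, hJ⟩ := hc I x X hX f
  let hY : IsColimit (Cofan.mk _ (Sigma.ι (fun j : J => x j))) := coproductIsCoproduct _
  obtain ⟨r, hr, hr'⟩ := exists_splitting_partialId hX J hY
  exact ⟨J, _, hY, f ≫ r, by rw [Category.assoc, hr', hJ]⟩

variable {D : Type u'} [Category.{v} D] [Preadditive D]

theorem map_partialId (F : C ⥤ D) [F.Additive] {I : Type v} {x : I → C} {X : Cofan x}
    (hX : IsColimit X)
    (hX' : IsColimit (Cofan.mk (F.obj X.pt) fun i => F.map (X.inj i))) (J : Finset I) :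
    F.map (partialId hX J) = partialId hX' J := by
  classical
  refine Cofan.IsColimit.hom_ext hX' _ _ fun i => ?_
  change F.map (X.inj i) ≫ _ = F.map (X.inj i) ≫ _
  rw [partialId, partialId, Preadditive.comp_sum, F.map_sum, Preadditive.comp_sum]
  refine Finset.sum_congr rfl fun j _ => ?_
  change _ = F.map (X.inj i) ≫ cofanProj hX' j ≫ F.map (X.inj j)
  rw [F.map_comp, ← Category.assoc, ← Category.assoc, ← F.map_comp]
  congr 1
  by_cases h : i = j
  · subst h
    exact (congrArg F.map (inj_cofanProj_self hX i)).trans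
      ((F.map_id _).trans (inj_cofanProj_self hX' i).symm)
  · exact (congrArg F.map (inj_cofanProj_of_ne hX h)).trans
      ((F.map_zero _ _).trans (inj_cofanProj_of_ne hX' h).symm)

theorem CommutesWithCoproducts.exists_comp_map_partialId_eq {F : C ⥤ D} [F.Additive]
    (hF : CommutesWithCoproducts F) {Y : D} (hY : compactObjects D Y) {I : Type v} {x : I → C}
    {X : Cofan x} (hX : IsColimit X) (f : Y ⟶ F.obj X.pt) :
    ∃ J : Finset I, f ≫ F.map (partialId hX J) = f := by
  obtain ⟨J, hJ⟩ := exists_comp_partialId_eq hY (hF.isColimit hX) f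
  exact ⟨J, (congrArg (f ≫ ·) (map_partialId F hX (hF.isColimit hX) J)).trans hJ⟩

/-- A left adjoint functor preserves compact objects if its right adjoint commutes with
coproducts. -/
theorem compactObjects_obj_of_adjunction [HasFiniteCoproducts D] {F : C ⥤ D} {G : D ⥤ C}
    [G.Additive] (adj : F ⊣ G) (hG : CommutesWithCoproducts G) {c : C}
    (hc : compactObjects C c) : compactObjects D (F.obj c) := by
  rw [compactObjects_iff]
  intro I x X hX f
  obtain ⟨J, hJ⟩ := hG.exists_comp_map_partialId_eq hc hX (adj.homEquiv _ _ f)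
  refine ⟨J, (adj.homEquiv _ _).injective ?_⟩
  rw [adj.homEquiv_naturality_right, hJ]

end Compact

/-! ### The triangulated subcategory of compact objects -/

section TriangulatedCompact

theorem commutesWithCoproducts_shiftFunctor {C : Type u} [Category.{v} C] [HasShift C ℤ] (n : ℤ) :
    CommutesWithCoproducts (shiftFunctor C n) :=
  fun _ => ⟨inferInstance⟩

variable {C : Type u} [Category.{v} C] [HasZeroObject C] [HasShift C ℤ] [Preadditive C]
  [∀ n : ℤ, (shiftFunctor C n).Additive]

variable [Pretriangulated C]

theorem compactObjects_shift {c : C} (hc : compactObjects C c) (n : ℤ) :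
    compactObjects C (c⟦n⟧) :=
  compactObjects_obj_of_adjunction (F := shiftFunctor C n) (G := shiftFunctor C (-n))
    (shiftEquiv' C n (-n) (by simp)).toAdjunction (commutesWithCoproducts_shiftFunctor (-n)) hc

theorem compactObjects_of_isZero {c : C} (hc : IsZero c) : compactObjects C c := by
  rw [compactObjects_iff]
  exact fun I x X hX f => ⟨∅, hc.eq_of_src _ _⟩

/-- On the first vertex f has finite support J, so f minus its part on J factors through the third
vertex and has finite support J'. Then f is supported on J ∪ J'. -/
theorem compactObjects_of_distTriang (T : Triangle C) (hT : T ∈ distTriang C)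
    (h₁ : compactObjects C T.obj₁) (h₃ : compactObjects C T.obj₃) :
    compactObjects C T.obj₂ := by
  classical
  rw [compactObjects_iff]
  intro I x X hX f
  obtain ⟨J, hJ⟩ := exists_comp_partialId_eq h₁ hX (T.mor₁ ≫ f)
  obtain ⟨k, hk⟩ := Triangle.yoneda_exact₂ T hT (f - f ≫ partialId hX J) (by
    rw [Preadditive.comp_sub, ← Category.assoc, hJ, sub_self])
  obtain ⟨J', hJ'⟩ := exists_comp_partialId_eq h₃ hX k
  refine ⟨J ∪ J', ?_⟩
  have e₁ : (f ≫ partialId hX J) ≫ partialId hX (J ∪ J') = f ≫ partialId hX J := by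
    rw [Category.assoc, partialId_comp_of_subset hX Finset.subset_union_left]
  have e₂ : (f - f ≫ partialId hX J) ≫ partialId hX (J ∪ J') = f - f ≫ partialId hX J := by
    rw [hk, Category.assoc, comp_partialId_of_subset hX hJ' Finset.subset_union_right]
  rwa [Preadditive.sub_comp, e₁, sub_left_inj] at e₂

open scoped ZeroObject in
instance : (compactObjects C).IsTriangulated where
  exists_zero := ⟨0, isZero_zero C, compactObjects_of_isZero (isZero_zero C)⟩
  isStableUnderShiftBy n := ⟨fun _ hc => compactObjects_shift hc n⟩
  ext₂' T hT h₁ h₃ := ObjectProperty.le_isoClosure _ _ (compactObjects_of_distTriang T hT h₁ h₃)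

theorem compactObjects_biprod {c d : C} (hc : compactObjects C c) (hd : compactObjects C d) :
    compactObjects C (c ⊞ d) :=
  compactObjects_of_distTriang _ (binaryBiproductTriangle_distinguished c d) hc hd

theorem compactObjects_of_finite {J : Type v'} [Finite J] {x : J → C}
    (hx : ∀ j, compactObjects C (x j)) {Y : Cofan x} (hY : IsColimit Y) :
    compactObjects C Y.pt := by
  classical
  have := Fintype.ofFinite J
  rw [compactObjects_iff]
  intro I z X hX f
  choose K hK using fun j => exists_comp_partialId_eq (hx j) hX (Y.inj j ≫ f)
  refine ⟨Finset.univ.biUnion K, Cofan.IsColimit.hom_ext hY _ _ fun j => ?_⟩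
  rw [← Category.assoc]
  exact comp_partialId_of_subset hX (hK j) (Finset.subset_biUnion_of_mem K (Finset.mem_univ j))

/-- A morphism from a compact object to the image of a coproduct of compact objects factors
through the image of a compact direct summand of the coproduct. -/
theorem CommutesWithCoproducts.exists_factorization {D : Type u'} [Category.{v} D]
    [Preadditive D] {F : C ⥤ D} [F.Additive] (hF : CommutesWithCoproducts F) {Y : D}
    (hY : compactObjects D Y) {I : Type v} {x : I → C} (hx : ∀ i, compactObjects C (x i))
    {X : Cofan x} (hX : IsColimit X) (f : Y ⟶ F.obj X.pt) :
    ∃ (c : C) (_ : compactObjects C c) (q : c ⟶ X.pt) (r : X.pt ⟶ c) (_ : q ≫ r = 𝟙 c)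
      (g : Y ⟶ F.obj c), g ≫ F.map q = f := by
  obtain ⟨J, hJ⟩ := hF.exists_comp_map_partialId_eq hY hX f
  let hY : IsColimit (Cofan.mk _ (Sigma.ι (fun j : J => x j))) := coproductIsCoproduct _
  obtain ⟨r, hr, hr'⟩ := exists_splitting_partialId hX J hY
  have hc := compactObjects_of_finite (J := J) (fun j => hx j) hY
  exact ⟨_, hc, _, r, hr, f ≫ F.map r, by
    rw [Category.assoc, ← F.map_comp, hr', hJ]⟩

end TriangulatedCompact
end

/-! ### Ghosts -/

/-- A morphism is a ghost with respect to a family `g` of objects if it kills all morphisms from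
the members of `g`. -/
def IsGhost {C : Type u} [Category.{v} C] [HasZeroMorphisms C] {ι : Type v'} (g : ι → C)
    {W W' : C} (w : W ⟶ W') : Prop :=
  ∀ (i : ι) (φ : g i ⟶ W), φ ≫ w = 0

section Ghost

variable {C : Type u} [Category.{v} C] [HasZeroObject C] [HasShift C ℤ] [Preadditive C]
  [∀ n : ℤ, (shiftFunctor C n).Additive] [Pretriangulated C]

/-- Let G be the coproduct over all morphisms from members of the family to W. Each of these
morphisms factors through p : G ⟶ W, hence dies in the cone of p. -/
theorem exists_ghost (hC : HasCoproducts.{v} C) {ι : Type v} (g : ι → C) (W : C) :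
    ∃ (I : Type v) (k : I → ι) (G : Cofan fun i => g (k i)) (_ : IsColimit G)
      (W' : C) (p : G.pt ⟶ W) (w : W ⟶ W') (δ : W' ⟶ G.pt⟦(1 : ℤ)⟧),
      Triangle.mk p w δ ∈ distTriang C ∧ IsGhost g w := by
  have := hC (Σ i, g i ⟶ W)
  let hG : IsColimit (Cofan.mk _ (Sigma.ι fun j : Σ i, g i ⟶ W => g j.1)) :=
    coproductIsCoproduct _
  let p := Cofan.IsColimit.desc hG fun j => j.2
  obtain ⟨W', w, δ, hT⟩ := distinguished_cocone_triangle p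
  refine ⟨_, _, _, hG, W', p, w, δ, hT, fun i φ => ?_⟩
  have h : p ≫ w = 0 := comp_distTriang_mor_zero₁₂ _ hT
  have h' : _ ≫ p = φ := Cofan.IsColimit.fac hG (fun j => j.2) ⟨i, φ⟩
  rw [← h']
  exact (Category.assoc _ _ _).trans ((congrArg (_ ≫ ·) h).trans comp_zero)

/-- The identity minus a ghost endomorphism is invertible, if the family which defines ghosts is
stable under desuspension and detects zero objects. -/
theorem IsGhost.isIso_id_sub {ι : Type v'} {g : ι → C}
    (hg : ∀ i, ∃ j, Nonempty (g j ≅ (g i)⟦(-1 : ℤ)⟧))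
    (hg' : ∀ x : C, (∀ (i : ι) (f : g i ⟶ x), f = 0) → IsZero x) {Z : C} {s : Z ⟶ Z}
    (hs : IsGhost g s) : IsIso (𝟙 Z - s) := by
  obtain ⟨K, a, b, hT⟩ := distinguished_cocone_triangle (𝟙 Z - s)
  have hs' : IsGhost g (s⟦(1 : ℤ)⟧') := by
    intro i φ
    obtain ⟨j, ⟨e⟩⟩ := hg i
    let adj : shiftFunctor C (-1 : ℤ) ⊣ shiftFunctor C (1 : ℤ) :=
      (shiftEquiv' C (-1 : ℤ) 1 (by simp)).toAdjunction
    apply (adj.homEquiv _ _).symm.injective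
    rw [adj.homEquiv_naturality_right_symm, ← cancel_epi e.hom, ← Category.assoc, hs j,
      adj.homEquiv_symm_apply, Functor.map_zero, zero_comp, comp_zero]
  -- The cone K is shown to vanish. Since b = b ≫ s⟦1⟧ and s⟦1⟧ is a ghost, φ ≫ b = 0, so φ = φ' ≫
  -- a. As φ' ≫ s = 0, also φ' = φ' ≫ (1 - s), which a kills.
  refine (Triangle.isZero₃_iff_isIso₁ _ hT).1 (hg' K fun i (φ : g i ⟶ K) => ?_)
  have h₁ : φ ≫ b = 0 := by
    have h : b ≫ (𝟙 Z - s)⟦(1 : ℤ)⟧' = 0 := comp_distTriang_mor_zero₃₁ _ hT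
    rw [Functor.map_sub, CategoryTheory.Functor.map_id, Preadditive.comp_sub, Category.comp_id,
      sub_eq_zero] at h
    rw [h, ← Category.assoc, hs']
  obtain ⟨φ', hφ'⟩ : ∃ φ' : g i ⟶ Z, φ = φ' ≫ a := Triangle.coyoneda_exact₃ _ hT φ h₁
  have h₂ : (𝟙 Z - s) ≫ a = 0 := comp_distTriang_mor_zero₁₂ _ hT
  rw [hφ', ← Category.comp_id φ', ← sub_zero (φ' ≫ 𝟙 Z), ← hs i φ', ← Preadditive.comp_sub,
    Category.assoc, h₂, comp_zero]

end Ghost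

/-! ### Sequences of ghosts -/

section Telescope

variable {C : Type u} [Category.{v} C] [HasZeroObject C] [HasShift C ℤ] [Preadditive C]
  [∀ n : ℤ, (shiftFunctor C n).Additive] [Pretriangulated C]
  {D : Type u'} [Category.{v} D] [Preadditive D]
  {F : C ⥤ D} [F.Additive]

/-- A morphism from a compact object to the image of the first term of a sequence of ghosts
vanishes in the image of some term of the sequence. -/
theorem exists_eq_zero_of_isGhost (hC : HasCoproducts.{v} C) (hF : CommutesWithCoproducts F)
    {ι : Type v'} {g : ι → C} (hgc : ∀ i, compactObjects C (g i))
    (hg : ∀ i, ∃ j, Nonempty (g j ≅ (g i)⟦(-1 : ℤ)⟧))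
    (hg' : ∀ x : C, (∀ (i : ι) (f : g i ⟶ x), f = 0) → IsZero x)
    {X : D} (hX : compactObjects D X) (W : ℕ → C) (w : ∀ n, W n ⟶ W (n + 1))
    (hw : ∀ n, IsGhost g (w n)) (f : ∀ n, X ⟶ F.obj (W n))
    (hf : ∀ n, f (n + 1) = f n ≫ F.map (w n)) : ∃ n, f n = 0 := by
  have := hC (ULift.{v} ℕ)
  obtain ⟨Z, hZ⟩ : ∃ Z : Cofan (fun n : ULift.{v} ℕ => W n.down), Nonempty (IsColimit Z) :=
    ⟨_, ⟨coproductIsCoproduct _⟩⟩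
  replace hZ := hZ.some
  let s : Z.pt ⟶ Z.pt := Cofan.IsColimit.desc hZ fun n => w n.down ≫ Z.inj ⟨n.down + 1⟩
  have hs (n : ULift.{v} ℕ) : Z.inj n ≫ s = w n.down ≫ Z.inj ⟨n.down + 1⟩ :=
    Cofan.IsColimit.fac hZ _ n
  -- Compactness of the family enters here: a morphism from g i has finite support, and each w n
  -- kills its component.
  have hsg : IsGhost g s := by
    intro i φ
    obtain ⟨J, hJ⟩ := exists_comp_partialId_eq (hgc i) hZ φ
    rw [← hJ, partialId, Preadditive.comp_sum, Preadditive.sum_comp]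
    refine Finset.sum_eq_zero fun n _ => ?_
    rw [Category.assoc, Category.assoc, hs, ← Category.assoc, ← Category.assoc, hw, zero_comp]
  have hiso := hsg.isIso_id_sub hg hg'
  have hs₀ : s ≫ cofanProj hZ ⟨0⟩ = 0 := Cofan.IsColimit.hom_ext hZ _ _ fun n => by
    rw [← Category.assoc, hs, Category.assoc, inj_cofanProj_of_ne, comp_zero, comp_zero]
    intro h
    simpa using congrArg ULift.down h
  have hs₁ (n : ℕ) : s ≫ cofanProj hZ ⟨n + 1⟩ = cofanProj hZ ⟨n⟩ ≫ w n :=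
    Cofan.IsColimit.hom_ext hZ _ _ fun m => by
      rw [← Category.assoc, hs, Category.assoc, ← Category.assoc (Z.inj m)]
      obtain ⟨m⟩ := m
      by_cases h : m = n
      · subst h
        rw [inj_cofanProj_self, inj_cofanProj_self, Category.comp_id, Category.id_comp]
      · rw [inj_cofanProj_of_ne hZ (by simpa using h), inj_cofanProj_of_ne hZ (by simpa using h),
          comp_zero, zero_comp]
  -- Formally this is the geometric series of s applied to f 0, so its n-th component is f n.
  -- Compactness of X makes y finitely supported, and some component must vanish.
  let y : X ⟶ F.obj Z.pt := f 0 ≫ F.map (Z.inj ⟨0⟩) ≫ F.map (inv (𝟙 _ - s))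
  have hy {V : C} (t : Z.pt ⟶ V) : y ≫ F.map t - y ≫ F.map (s ≫ t) =
      f 0 ≫ F.map (Z.inj ⟨0⟩ ≫ t) := by
    have e : t - s ≫ t = (𝟙 _ - s) ≫ t := by rw [Preadditive.sub_comp, Category.id_comp]
    rw [← Preadditive.comp_sub, ← F.map_sub, e, Category.assoc, Category.assoc, ← F.map_comp,
      ← F.map_comp, IsIso.inv_hom_id_assoc]
  have hyf (n : ℕ) : y ≫ F.map (cofanProj hZ ⟨n⟩) = f n := by
    induction n with
    | zero =>
      have := hy (cofanProj hZ ⟨0⟩)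
      rwa [hs₀, F.map_zero, comp_zero, sub_zero, inj_cofanProj_self, F.map_id,
        Category.comp_id] at this
    | succ n ih =>
      have := hy (cofanProj hZ ⟨n + 1⟩)
      rw [hs₁, inj_cofanProj_of_ne hZ (by simp), F.map_zero, comp_zero, sub_eq_zero,
        F.map_comp, ← Category.assoc] at this
      rw [this, ih, hf]
  obtain ⟨J, hJ⟩ := hF.exists_comp_map_partialId_eq hX hZ y
  obtain ⟨n, hn⟩ := Infinite.exists_notMem_finset J
  refine ⟨n.down, ?_⟩
  rw [← hyf, ← hJ, Category.assoc, ← F.map_comp, partialId_cofanProj_of_notMem hZ hn, F.map_zero,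
    comp_zero]

end Telescope

/-! ### Factoring morphisms through compact objects -/

section Factorization

variable {C : Type u} [Category.{v} C] [HasZeroObject C] [HasShift C ℤ] [Preadditive C]
  [∀ n : ℤ, (shiftFunctor C n).Additive] [Pretriangulated C]
  {D : Type u'} [Category.{v} D] [HasZeroObject D] [HasShift D ℤ] [Preadditive D]
  [∀ n : ℤ, (shiftFunctor D n).Additive] [Pretriangulated D]
  {F : C ⥤ D} [F.CommShift ℤ] [F.IsTriangulated]

/-- A morphism to `F W` which factors through `F c` for some compact object `c` over `W`. -/
def FactorsThroughCompact (F : C ⥤ D) {X : D} {W : C} (f : X ⟶ F.obj W) : Prop :=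
  ∃ (c : C) (_ : compactObjects C c) (a : X ⟶ F.obj c) (u : c ⟶ W), a ≫ F.map u = f

/-- If the composite factors through c₁ over W', then c₁ ⟶ W' ⟶ G⟦1⟧ factors through c₀⟦1⟧ for a
compact summand c₀ of G. Completing c₁ ⟶ c₀⟦1⟧ to a triangle gives a compact c over W through which
f factors up to a morphism coming from F(G). That error passes through F(c₂) for a compact summand
c₂ of G, so c ⊞ c₂ works. -/
theorem FactorsThroughCompact.of_comp (hF : CommutesWithCoproducts F) {X : D}
    (hX : compactObjects D X) {I : Type v} {x : I → C} (hx : ∀ i, compactObjects C (x i))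
    {G : Cofan x} (hG : IsColimit G) {W W' : C} {p : G.pt ⟶ W} {w : W ⟶ W'}
    {δ : W' ⟶ G.pt⟦(1 : ℤ)⟧} (hT : Triangle.mk p w δ ∈ distTriang C) {f : X ⟶ F.obj W}
    (hf : FactorsThroughCompact F (f ≫ F.map w)) : FactorsThroughCompact F f := by
  obtain ⟨c₁, hc₁, f₁, u₁, hfu⟩ := hf
  have hwδ : w ≫ δ = 0 := comp_distTriang_mor_zero₂₃ _ hT
  have hpw : p ≫ w = 0 := comp_distTriang_mor_zero₁₂ _ hT
  obtain ⟨c₀, hc₀, q, r, hqr, ψ, hψ⟩ :=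
    (commutesWithCoproducts_shiftFunctor (C := C) 1).exists_factorization hc₁ hx hG (u₁ ≫ δ)
  obtain ⟨c, a, b, hT'⟩ := distinguished_cocone_triangle₂ ψ
  have hc : compactObjects C c := compactObjects_of_distTriang _ hT' hc₀ hc₁
  obtain ⟨u, -, hu⟩ : ∃ u : c ⟶ W, a ≫ u = q ≫ p ∧ b ≫ u₁ = u ≫ w :=
    complete_distinguished_triangle_morphism₂ _ _ hT' hT q u₁ hψ
  -- The composite vanishes in F(G⟦1⟧) because w ≫ δ = 0, and the retraction r of q allows q to be
  -- cancelled.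
  have hfψ : f₁ ≫ F.map ψ = 0 := by
    have e : f₁ ≫ F.map ψ ≫ F.map (q⟦(1 : ℤ)⟧') = 0 := by
      rw [← F.map_comp, hψ, F.map_comp, reassoc_of% hfu, ← F.map_comp, hwδ, F.map_zero, comp_zero]
    have e' := congrArg (· ≫ F.map (r⟦(1 : ℤ)⟧')) e
    simpa only [Category.assoc, ← F.map_comp, ← Functor.map_comp, hqr,
      CategoryTheory.Functor.map_id, Category.comp_id, zero_comp] using e'
  obtain ⟨a', ha'⟩ : ∃ a' : X ⟶ F.obj c, f₁ = a' ≫ F.map b :=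
    Triangle.coyoneda_exact₃ _ (F.map_distinguished _ hT') f₁
      ((Category.assoc _ _ _).symm.trans ((congrArg (· ≫ _) hfψ).trans zero_comp))
  obtain ⟨b', hb'⟩ : ∃ b' : X ⟶ F.obj G.pt, f - a' ≫ F.map u = b' ≫ F.map p :=
    Triangle.coyoneda_exact₂ _ (F.map_distinguished _ hT) (f - a' ≫ F.map u) (by
      change (f - a' ≫ F.map u) ≫ F.map w = 0
      rw [Preadditive.sub_comp, Category.assoc, ← F.map_comp, ← hu, ← hfu, ha', F.map_comp,
        Category.assoc, sub_self])
  obtain ⟨c₂, hc₂, q₂, -, -, b₂, hb₂⟩ := hF.exists_factorization hX hx hG b'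
  refine ⟨c ⊞ c₂, compactObjects_biprod hc hc₂,
    a' ≫ F.map biprod.inl + b₂ ≫ F.map biprod.inr, biprod.desc u (q₂ ≫ p), ?_⟩
  rw [Preadditive.add_comp, Category.assoc, Category.assoc, ← F.map_comp, ← F.map_comp,
    biprod.inl_desc, biprod.inr_desc, F.map_comp, reassoc_of% hb₂, ← hb']
  abel

/-- A morphism from a compact object to `F W` factors through `F c` for some compact object
`c` over `W`. -/
theorem factorsThroughCompact (hC : IsCompactlyGenerated C) (hF : CommutesWithCoproducts F) {X : D}
    (hX : compactObjects D X) {W : C} (f : X ⟶ F.obj W) : FactorsThroughCompact F f := by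
  obtain ⟨hC, ι, g₀, hg₀, hg₀'⟩ := hC
  -- All shifts of the generators are included because inverting 1 minus a ghost requires stability
  -- under desuspension.
  let g : ι × ℤ → C := fun j => (g₀ j.1)⟦j.2⟧
  have hgc (j) : compactObjects C (g j) := compactObjects_shift (hg₀ _) _
  have hg (j) : ∃ k, Nonempty (g k ≅ (g j)⟦(-1 : ℤ)⟧) :=
    ⟨(j.1, j.2 - 1), ⟨(shiftFunctorAdd' C j.2 (-1) (j.2 - 1) (by omega)).app (g₀ j.1)⟩⟩
  have hg' (x : C) (hx : ∀ (j) (f : g j ⟶ x), f = 0) : IsZero x := hg₀' x fun i φ => by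
    rw [← cancel_epi ((shiftFunctorZero C ℤ).hom.app (g₀ i)), comp_zero]
    exact hx (i, 0) _
  by_contra hfac
  -- By `FactorsThroughCompact.of_comp`, failure to factor persists after a ghost, so it can be
  -- iterated. The resulting tower eventually reaches 0, which factors through the zero object.
  have step (p : {p : Σ W : C, X ⟶ F.obj W // ¬ FactorsThroughCompact F p.2}) :
      ∃ (p' : {p : Σ W : C, X ⟶ F.obj W // ¬ FactorsThroughCompact F p.2})
        (w : p.1.1 ⟶ p'.1.1), IsGhost g w ∧ p'.1.2 = p.1.2 ≫ F.map w := by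
    obtain ⟨I, k, G, hG, W', q, w, δ, hT, hw⟩ := exists_ghost hC g p.1.1
    exact ⟨⟨⟨W', p.1.2 ≫ F.map w⟩, fun h => p.2 (.of_comp hF hX (fun i => hgc (k i)) hG hT h)⟩,
      w, hw, rfl⟩
  choose next w hw hnext using step
  let seq (n : ℕ) : {p : Σ W : C, X ⟶ F.obj W // ¬ FactorsThroughCompact F p.2} :=
    Nat.rec ⟨⟨W, f⟩, hfac⟩ (fun _ => next) n
  obtain ⟨n, hn⟩ := exists_eq_zero_of_isGhost hC hF hgc hg hg' hX (fun n => (seq n).1.1)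
    (fun n => w (seq n)) (fun n => hw (seq n)) (fun n => (seq n).1.2) (fun n => hnext (seq n))
  refine (seq n).2 ⟨_, compactObjects_of_isZero (isZero_zero C), 0, 0, ?_⟩
  rw [hn, zero_comp]

end Factorization

/-! ### Coproducts and compact generation for modules -/

section CompactModules

variable {C : Type u} [Category.{v} C] {A : CategoryTheory.Monad C}

/-- The forgetful functor creates the colimits that the monad preserves. -/
theorem CommutesWithCoproducts.hasCoproducts_algebra (hC : HasCoproducts.{v} C)
    (hA : CommutesWithCoproducts A.toFunctor) : HasCoproducts.{v} A.Algebra := fun I => by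
  have := (hA I).some
  have := hC I
  exact hasColimitsOfShape_of_hasColimitsOfShape_createsColimitsOfShape A.forget

theorem CommutesWithCoproducts.forget (hC : HasCoproducts.{v} C)
    (hA : CommutesWithCoproducts A.toFunctor) : CommutesWithCoproducts A.forget := fun I => by
  have := (hA I).some
  have := hC I
  exact ⟨inferInstance⟩

theorem commutesWithCoproducts_free : CommutesWithCoproducts A.free := fun _ =>
  ⟨A.adj.leftAdjoint_preservesColimits.1⟩

theorem isZero_algebra [Preadditive C] [A.toFunctor.Additive] {X : A.Algebra}
    (hX : IsZero X.A) : IsZero X :=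
  (IsZero.iff_id_eq_zero X).2 (Monad.Algebra.Hom.ext (hX.eq_of_src _ _))

theorem modulesIn_iff {P : ObjectProperty C} (hP : ∀ x, P x → P (A.obj x)) (X : A.Algebra) :
    modulesIn A P hP X ↔ P X.A := by
  constructor
  · rintro ⟨M, rfl⟩
    exact M.A.property
  · intro h
    exact ⟨{ A := ⟨X.A, h⟩
             a := ObjectProperty.homMk X.a
             unit := by ext; exact X.unit
             assoc := by ext; exact X.assoc }, rfl⟩

variable [Preadditive C] [A.toFunctor.Additive] [HasFiniteCoproducts A.Algebra]

theorem compactObjects_free (hC : HasCoproducts.{v} C)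
    (hA : CommutesWithCoproducts A.toFunctor) {c : C} (hc : compactObjects C c) :
    compactObjects A.Algebra (A.free.obj c) :=
  compactObjects_obj_of_adjunction A.adj (hA.forget hC) hc

theorem isCompactlyGenerated_algebra (hC : IsCompactlyGenerated C)
    (hA : CommutesWithCoproducts A.toFunctor) : IsCompactlyGenerated A.Algebra := by
  obtain ⟨hC, ι, g, hg, hg'⟩ := hC
  refine ⟨hA.hasCoproducts_algebra hC, ι, fun i => A.free.obj (g i),
    fun i => compactObjects_free hC hA (hg i),
    fun x hx => isZero_algebra (hg' _ fun i f => ?_)⟩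
  exact (A.adj.homEquiv (g i) x).symm.injective ((hx i _).trans (hx i _).symm)

end CompactModules

/-! ### Identification of the compact modules -/

section Thick

variable {C : Type u} [Category.{v} C] [HasZeroObject C] [HasShift C ℤ] [Preadditive C]
  [∀ n : ℤ, (shiftFunctor C n).Additive] [Pretriangulated C]
  {A : CategoryTheory.Monad C} [A.toFunctor.CommShift ℤ] [A.toFunctor.IsTriangulated]
  [NatTrans.CommShift A.η ℤ] [NatTrans.CommShift A.μ ℤ]

/-- Every compact module over a separable smashing monad is a direct summand of the free module
on a compact object. -/
theorem exists_retract_free [IsIdempotentComplete C] (hC : IsCompactlyGenerated C)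
    (α : Averaging A) {X : A.Algebra} (hX : compactObjects A.Algebra X) :
    ∃ c : C, compactObjects C c ∧ Nonempty (Retract X (A.free.obj c)) := by
  let := modPretriangulated α
  have := (modPretriangulated_isCompatible α).2
  obtain ⟨c, hc, a, u, hau⟩ :=
    factorsThroughCompact hC commutesWithCoproducts_free hX (α.retract X).i
  exact ⟨c, hc, ⟨{ i := a
                   r := A.free.map u ≫ (α.retract X).r
                   retract := by rw [← Category.assoc, hau, (α.retract X).retract] }⟩⟩

/-- Retracts alone reach every compact module, and compact modules themselves form a triangulated
subcategory closed under retracts. -/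
theorem compactObjects_algebra_eq_thick [IsIdempotentComplete C] (hC : IsCompactlyGenerated C)
    (α : Averaging A) (hA : CommutesWithCoproducts A.toFunctor) :
    letI := modPretriangulated α
    compactObjects A.Algebra = thick ((compactObjects C).map A.free) := by
  let := modPretriangulated α
  ext X
  constructor
  · intro hX Q _ _ hQ
    obtain ⟨c, hc, ⟨r⟩⟩ := exists_retract_free hC α hX
    exact Q.prop_of_retract r (hQ _ (ObjectProperty.prop_map_obj _ _ hc))
  · intro hX
    refine hX _ inferInstance inferInstance ?_
    rintro Y ⟨c, hc, ⟨e⟩⟩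
    exact (compactObjects A.Algebra).prop_of_iso e (compactObjects_free hC.1 hA hc)

/-- If X is a retract of F(c), then UX is a retract of A(c), which is compact by `hc`. Conversely X
is a retract of F(UX). -/
theorem compactObjects_algebra_eq_modulesIn [IsIdempotentComplete C]
    (hC : IsCompactlyGenerated C) (α : Averaging A) (hA : CommutesWithCoproducts A.toFunctor)
    (hc : ∀ c : C, compactObjects C c → compactObjects C (A.obj c)) :
    compactObjects A.Algebra = modulesIn A (compactObjects C) hc := by
  let := modPretriangulated α
  ext X
  rw [modulesIn_iff]
  constructor
  · intro hX
    obtain ⟨c, hcc, ⟨r⟩⟩ := exists_retract_free hC α hX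
    exact compactObjects_of_retract (r.map A.forget) (hc c hcc)
  · intro hX
    exact compactObjects_of_retract (α.retract X) (compactObjects_free hC.1 hA hX)

end Thick
end SepExt

theorem theorem4p2 {S : Type u} [Category.{v} S] [HasZeroObject S] [HasShift S ℤ] [Preadditive S]
    [∀ n : ℤ, (shiftFunctor S n).Additive] [Pretriangulated S] [IsTriangulated S]
    (hS : SepExt.IsCompactlyGenerated S)
    (A : CategoryTheory.Monad S) [A.toFunctor.CommShift ℤ] [A.toFunctor.IsTriangulated]
    [NatTrans.CommShift A.η ℤ] [NatTrans.CommShift A.μ ℤ]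
    (hsep : SepExt.IsSeparable A) (hsmash : SepExt.CommutesWithCoproducts A.toFunctor) :
    -- the triangulation of the category of modules
    ∃ P : Pretriangulated A.Algebra,
      SepExt.IsCompatible A P ∧
      (∀ P' : Pretriangulated A.Algebra, SepExt.IsCompatible A P' → P' = P) ∧
      -- octahedra and higher triangles
      (∀ (N : ℕ∞) (_ : 2 ≤ N) (H : SepExt.HigherTriangulation S N)
        (_ : SepExt.IsExactOfOrder A.toFunctor H H),
        (∃ K : SepExt.HigherTriangulation A.Algebra N,
          SepExt.IsExactOfOrder A.forget K H ∧ SepExt.IsExactOfOrder A.free H K ∧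
          ∀ K' : SepExt.HigherTriangulation A.Algebra N,
            SepExt.IsExactOfOrder A.forget K' H → SepExt.IsExactOfOrder A.free H K' →
              ∀ n : ℕ, (n : ℕ∞) ≤ N → K'.dist n = K.dist n) ∧
        (3 ≤ N → IsTriangulated A.Algebra)) ∧
      -- compact generation and the compact objects
      SepExt.IsCompactlyGenerated A.Algebra ∧
      SepExt.compactObjects A.Algebra =
        SepExt.thick ((SepExt.compactObjects S).map A.free) ∧
      -- the case where the monad preserves compact objects
      ∀ hc : ∀ c : S, SepExt.compactObjects S c → SepExt.compactObjects S (A.obj c),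
        SepExt.compactObjects A.Algebra =
          SepExt.modulesIn A (SepExt.compactObjects S) hc ∧
        ∀ X : A.Algebra, SepExt.compactObjects A.Algebra X →
          ∃ c : S, SepExt.compactObjects S c ∧ Nonempty (Retract X (A.free.obj c)) := by
  obtain ⟨α⟩ := hsep.nonempty_averaging
  have := SepExt.isIdempotentComplete_of_hasCoproducts hS.1
  let P := SepExt.modPretriangulated α
  refine ⟨P, SepExt.modPretriangulated_isCompatible α, SepExt.eq_modPretriangulated α,
    fun N hN H hA => ⟨⟨SepExt.modHigherTriangulation α H hA hN,
      SepExt.modHigherTriangulation_forget α H hA hN,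
      SepExt.modHigherTriangulation_free α H hA hN,
      fun K hK _ n hn => SepExt.dist_eq_modHigherTriangulation_dist α H hA hN K hK n hn⟩,
      fun h3 => (SepExt.modHigherTriangulation α H hA hN).isTriangulated h3⟩,
    SepExt.isCompactlyGenerated_algebra hS hsmash,
    SepExt.compactObjects_algebra_eq_thick hS α hsmash,
    fun hc => ⟨SepExt.compactObjects_algebra_eq_modulesIn hS α hsmash hc,
      fun X hX => SepExt.exists_retract_free hS α hX⟩⟩
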